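/- All trees are finite, and a weighted tree $\mathcal T=(T,w)$ is a tree $T$ with a function $w:E(T)\to\mathbb R$; it is positive-weighted if $w>0$. Its leaves are its vertices of degree $1$, its nodes the vertices of degree greater than $2$; it is essential if it has no vertex of degree $2$. The twig of a leaf is the path joining it to a node and containing no other node; its weight is the sum of the weights of its edges. The total weight $D_{tot}(\mathcal T)$ is the sum of the weights of all edges, and, for a nonempty set $I$ of leaves, $D_I(\mathcal T)$ is the sum of the weights of the edges of the minimal subtree containing $I$. Two weighted trees with the same leaf set are called equivalent if they become isomorphic (by an isomorphism fixing the leaves and preserving the weights) after all vertices of degree $2$ are suppressed, i.e. the two edges at such a vertex are replaced by one edge whose weight is the sum of theirs. A pseudostar of kind $(n,k)$ is a tree with $n$ leaves each of whose edges divides the leaf set into two parts at least one of which has at least $k$ elements. **Theorem.** Let $k,n\in\mathbb N$ with $3\le k\le n-1$, and let $\{D_I\}$, $I$ ranging over the $k$-subsets of $[n]=\{1,\dots,n\}$, be a family of positive real numbers such that there is a positive-weighted tree $\mathcal T$ whose leaf set contains $[n]$ and with $D_I(\mathcal T)=D_I$ for all $I$. Let $U$ be the set of the positive-weighted trees $\mathcal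 T$ whose leaf set is exactly $[n]$ and such that $D_I(\mathcal T)=D_I$ for all $I$. Then $U$ contains an essential pseudostar $\mathcal P$ of kind $(n,k)$, unique up to isomorphism (fixing the leaves and preserving the weights), and: (i) $\sup_{\mathcal T\in U} D_{tot}(\mathcal T)=D_{tot}(\mathcal P)$, and the supremum is attained, up to equivalence, only by $\mathcal P$; (ii) the twigs of $\mathcal P$ have a minimum weight $m$, and if $U$ contains two inequivalent trees (i.e. $\#U>1$, trees being counted up to equivalence), then $\inf_{\mathcal T\in U} D_{tot}(\mathcal T)=D_{tot}(\mathcal P)-(n-k)\cdot m$, and the infimum is not attained. -/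

import Mathlib

/-- A finite real-weighted tree in which `n` distinct leaves (vertices of degree one) carry the
labels of `Fin n`; there may be further, unlabelled leaves.  The weight function is defined on all
unordered pairs of vertices, but only its values on the edges are ever used. -/
structure LeafLabelledTree (n : ℕ) where
  /-- the vertices -/
  V : Type
  [finite : Finite V]
  /-- the underlying graph -/
  G : SimpleGraph V
  isTree : G.IsTree
  /-- the weights of the edges -/
  w : Sym2 V → ℝ
  /-- the leaf with a given label -/
  leaf : Fin n → V
  leaf_injective : Function.Injective leaf
  leaf_degree : ∀ i, (G.neighborSet (leaf i)).ncard = 1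

attribute [instance] LeafLabelledTree.finite

namespace LeafLabelledTree

variable {n : ℕ}

/-- The degree of a vertex. -/
noncomputable def deg (T : LeafLabelledTree n) (v : T.V) : ℕ :=
  (T.G.neighborSet v).ncard

/-- The leaf set of `T` is exactly the set of labels: every vertex of degree one is labelled. -/
def LeafSetEq (T : LeafLabelledTree n) : Prop :=
  ∀ v : T.V, T.deg v = 1 → ∃ i, T.leaf i = v

/-- All edges have positive weight. -/
def PositiveWeighted (T : LeafLabelledTree n) : Prop :=
  ∀ e ∈ T.G.edgeSet, 0 < T.w e

/-- The weight of a subgraph: the sum of the weights of its edges. -/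
noncomputable def weight (T : LeafLabelledTree n) (H : T.G.Subgraph) : ℝ :=
  ∑ e ∈ (Set.toFinite H.edgeSet).toFinset, T.w e

/-- The total weight of the tree. -/
noncomputable def totalWeight (T : LeafLabelledTree n) : ℝ :=
  T.weight ⊤

/-- The minimal subtree containing a (nonempty) set `S` of vertices: the intersection of all
connected subgraphs that contain `S`. -/
def minSubtree (T : LeafLabelledTree n) (S : Set T.V) : T.G.Subgraph :=
  sInf {H | H.Connected ∧ S ⊆ H.verts}

/-- The multiweight `D_I(T)`: the weight of the minimal subtree connecting the leaves with labels
in `I`. -/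
noncomputable def multiweight (T : LeafLabelledTree n) (I : Finset (Fin n)) : ℝ :=
  T.weight (T.minSubtree (T.leaf '' (I : Set (Fin n))))

/-- The `k`-weights of `T` at its labelled leaves are the given numbers. -/
def Realizes {k : ℕ} (T : LeafLabelledTree n)
    (D : {I : Finset (Fin n) // I.card = k} → ℝ) : Prop :=
  ∀ I, T.multiweight I.1 = D I

/-- No vertex has degree two. -/
def Essential (T : LeafLabelledTree n) : Prop :=
  ∀ v : T.V, T.deg v ≠ 2

/-- The labels of the leaves that lie on the side of `u` once the edge `uv` is removed. -/
def side (T : LeafLabelledTree n) (u v : T.V) : Set (Fin n) :=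
  {i | (T.G.deleteEdges {s(u, v)}).Reachable u (T.leaf i)}

/-- Pseudostar of kind `(n, k)`: the leaf set is the set of the `n` labels, and every edge divides
it into two parts at least one of which has at least `k` elements. -/
def IsPseudostar (T : LeafLabelledTree n) (k : ℕ) : Prop :=
  T.LeafSetEq ∧
    ∀ u v : T.V, T.G.Adj u v → k ≤ (T.side u v).ncard ∨ k ≤ (T.side v u).ncard

/-- The weight of a walk (used for paths only): the sum of the weights of its edges. -/
def walkWeight (T : LeafLabelledTree n) {u v : T.V} (p : T.G.Walk u v) : ℝ :=
  (p.edges.map T.w).sum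

/-- The path `p` is the twig of the leaf with label `i`: it joins that leaf to a node (a vertex of
degree greater than two) and contains no other node. -/
def IsTwig (T : LeafLabelledTree n) (i : Fin n) {N : T.V} (p : T.G.Walk (T.leaf i) N) : Prop :=
  p.IsPath ∧ 2 < T.deg N ∧ ∀ x ∈ p.support, 2 < T.deg x → x = N

/-- The set of the weights of the twigs of the labelled leaves. -/
def twigWeights (T : LeafLabelledTree n) : Set ℝ :=
  {r | ∃ (i : Fin n) (N : T.V) (p : T.G.Walk (T.leaf i) N), T.IsTwig i p ∧ T.walkWeight p = r}

/-- Isomorphism of weighted trees, respecting the labels and the weights. -/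
def Isomorphic (T T' : LeafLabelledTree n) : Prop :=
  ∃ φ : T.G ≃g T'.G, (∀ i, φ (T.leaf i) = T'.leaf i) ∧
    ∀ u v, T.G.Adj u v → T'.w s(φ u, φ v) = T.w s(u, v)

/-- `a` and `b` are joined by a path of total weight `r` all of whose interior vertices have
degree two.  For `a`, `b` not of degree two this says that suppressing the vertices of degree two
(replacing the two edges at such a vertex by one edge carrying the sum of their weights)
leaves an edge `ab` of weight `r`. -/
def ReducedEdge (T : LeafLabelledTree n) (a b : T.V) (r : ℝ) : Prop :=
  a ≠ b ∧ ∃ p : T.G.Walk a b, p.IsPath ∧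
    (∀ x ∈ p.support, x = a ∨ x = b ∨ T.deg x = 2) ∧ T.walkWeight p = r

/-- Two weighted trees are equivalent if they become isomorphic (as labelled weighted trees) when
all vertices of degree two are suppressed. -/
def Equivalent (T T' : LeafLabelledTree n) : Prop :=
  ∃ φ : {v : T.V // T.deg v ≠ 2} ≃ {v : T'.V // T'.deg v ≠ 2},
    (∀ (i : Fin n) (a : {v : T.V // T.deg v ≠ 2}), a.1 = T.leaf i → (φ a).1 = T'.leaf i) ∧
    ∀ (a b : {v : T.V // T.deg v ≠ 2}) (r : ℝ),
      T.ReducedEdge a.1 b.1 r ↔ T'.ReducedEdge (φ a).1 (φ b).1 r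

end LeafLabelledTree

/-- The family `D` is p-l-treelike: it is the family of the `k`-weights, at `n` labelled leaves, of
some positive-weighted tree (which may have other leaves). -/
def PLTreelike {n k : ℕ} (D : {I : Finset (Fin n) // I.card = k} → ℝ) : Prop :=
  ∃ T : LeafLabelledTree n, T.PositiveWeighted ∧ T.Realizes D

/-- The positive-weighted trees whose leaf set is exactly the set of the `n` labels and that
realize the family `D`. -/
def positiveRealizations {n k : ℕ} (D : {I : Finset (Fin n) // I.card = k} → ℝ) :
    Set (LeafLabelledTree n) :=
  {T | T.LeafSetEq ∧ T.PositiveWeighted ∧ T.Realizes D}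

/-! ### Trees rooted at a labelled leaf: parents, ancestors, and the cut at an edge -/

namespace LeafLabelledTree

open SimpleGraph Finset
open scoped Classical

variable {n : ℕ}

/-! Root every tree at a labelled leaf `o`. An edge is then named by its lower end, and its split by
its cluster, the set of labels below that end. Let f(A) (`splitWeight`) be the total weight of the
edges with cluster A. For positive weights f is nonnegative; it is laminar and vanishes on sets
containing `o`. It carries all the information needed: the k-weight of I is the sum of f over the A
that separate I (`multiweight_eq_sepSum`), the total weight is the sum of all f(A)
(`totalWeight_eq_sum`), and, if all leaves are labelled, f determines the positive-weighted tree up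
to equivalence (`equivalent_of_splitWeight_eq`). Conversely, such an f with f(∅) = 0 and positive
values at the pendant splits comes from an essential tree, the Hasse diagram of its support together
with the full set (`clusterTree`).

Call a split bad if both its parts have fewer than k labels. A bad split separates every k-set,
while a k-set is separated by exactly k of the n pendant splits. So the bad splits, of total weight
b, may be removed and b/k added to each pendant split without changing any k-weight
(`sepSum_contract`); when f(∅) = 0 the total weight grows by n(b/k) - b = (n-k)b/k (`sum_contract`).
The result belongs to a pseudostar P, and it is the same for all realizations, because a laminar
weight without bad splits is determined by its k-weights (`eq_of_sepSum_eq`). The proof of this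
averages the k-weights over the k-sets through a pair of labels and reads f off the resulting Gromov
products at `o`.

Hence D_tot(P) = D_tot(T) + (n-k)b/k for every T in U, which gives (i), since b = 0 forces T and P
to have the same split weights. For (ii), each pendant weight of P is the positive one of T plus
b/k, so b/k < m. If U has two inequivalent trees, then one of them has b > 0, and rescaling its bad
edges, with compensation at the leaves, makes b/k any number in (0, m) (`exists_rescaling`). -/

noncomputable instance fintypeVertices (T : LeafLabelledTree n) : Fintype T.V :=
  Fintype.ofFinite _

/-- The unique path from a vertex to the root, the leaf with label `o`. -/
noncomputable def rootPath (T : LeafLabelledTree n) (o : Fin n) (x : T.V) :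
    T.G.Walk x (T.leaf o) :=
  (T.isTree.existsUnique_path x (T.leaf o)).choose

/-- The vertex `v` lies on the path from `x` to the root. -/
def Below (T : LeafLabelledTree n) (o : Fin n) (x v : T.V) : Prop :=
  v ∈ (T.rootPath o x).support

/-- The next vertex on the way to the root. -/
noncomputable def par (T : LeafLabelledTree n) (o : Fin n) (x : T.V) : T.V :=
  (T.rootPath o x).snd

variable (T : LeafLabelledTree n) (o : Fin n)

theorem rootPath_isPath (x : T.V) : (T.rootPath o x).IsPath :=
  (T.isTree.existsUnique_path x (T.leaf o)).choose_spec.1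

theorem eq_rootPath {x : T.V} (p : T.G.Walk x (T.leaf o)) (hp : p.IsPath) :
    p = T.rootPath o x :=
  (T.isTree.existsUnique_path x (T.leaf o)).choose_spec.2 p hp

theorem rootPath_root : T.rootPath o (T.leaf o) = Walk.nil :=
  (T.eq_rootPath o _ Walk.IsPath.nil).symm

theorem below_refl (x : T.V) : T.Below o x x := Walk.start_mem_support _

theorem below_root (x : T.V) : T.Below o x (T.leaf o) := Walk.end_mem_support _

theorem root_below_iff {v : T.V} : T.Below o (T.leaf o) v ↔ v = T.leaf o := by
  simp [Below, rootPath_root]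

theorem exists_rootPath_eq_cons {x : T.V} (hx : x ≠ T.leaf o) :
    ∃ h : T.G.Adj x (T.par o x), T.rootPath o x = Walk.cons h (T.rootPath o (T.par o x)) := by
  have key : ∃ (y : T.V) (h : T.G.Adj x y), T.rootPath o x = Walk.cons h (T.rootPath o y) := by
    have hp := T.rootPath_isPath o x
    generalize T.rootPath o x = q at hp
    cases q with
    | nil => exact absurd rfl hx
    | cons h q' => exact ⟨_, h, by rw [T.eq_rootPath o q' hp.of_cons]⟩
  obtain ⟨y, h, e⟩ := key
  have hy : T.par o x = y := by unfold par; rw [e]; simp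
  subst hy
  exact ⟨h, e⟩

theorem adj_par {x : T.V} (hx : x ≠ T.leaf o) : T.G.Adj x (T.par o x) :=
  (T.exists_rootPath_eq_cons o hx).1

theorem below_iff {x v : T.V} (hx : x ≠ T.leaf o) :
    T.Below o x v ↔ v = x ∨ T.Below o (T.par o x) v := by
  obtain ⟨h, e⟩ := T.exists_rootPath_eq_cons o hx
  unfold Below
  rw [e]
  simp

theorem not_par_below {x : T.V} (hx : x ≠ T.leaf o) : ¬ T.Below o (T.par o x) x := by
  obtain ⟨h, e⟩ := T.exists_rootPath_eq_cons o hx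
  have hp := T.rootPath_isPath o x
  rw [e] at hp
  exact ((Walk.cons_isPath_iff _ _).1 hp).2

theorem below_par {x : T.V} (hx : x ≠ T.leaf o) : T.Below o x (T.par o x) :=
  (T.below_iff o hx).2 (Or.inr (T.below_refl o _))

/-- The number of edges between a vertex and the root. -/
noncomputable def depth (x : T.V) : ℕ := (T.rootPath o x).length

theorem depth_par {x : T.V} (hx : x ≠ T.leaf o) :
    T.depth o x = T.depth o (T.par o x) + 1 := by
  obtain ⟨h, e⟩ := T.exists_rootPath_eq_cons o hx
  unfold depth
  rw [e]
  simp

theorem root_induction {motive : T.V → Prop} (root : motive (T.leaf o))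
    (step : ∀ x, x ≠ T.leaf o → motive (T.par o x) → motive x) (x : T.V) : motive x := by
  induction h : T.depth o x using Nat.strong_induction_on generalizing x with
  | _ d ih =>
    by_cases hx : x = T.leaf o
    · exact hx ▸ root
    · exact step x hx (ih _ (by have := T.depth_par o hx; omega) _ rfl)

variable {T o}

theorem Below.trans {x y z : T.V} (h : T.Below o x y) (h' : T.Below o y z) : T.Below o x z := by
  induction x using T.root_induction o with
  | root => rw [root_below_iff] at h; exact h ▸ h'
  | step x hx ih =>
    rcases (T.below_iff o hx).1 h with rfl | h
    · exact h'
    · exact (T.below_iff o hx).2 (Or.inr (ih h))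

theorem Below.eq_or_depth_lt {x y : T.V} (h : T.Below o x y) :
    y = x ∨ T.depth o y < T.depth o x := by
  induction x using T.root_induction o with
  | root => exact Or.inl ((T.root_below_iff o).1 h)
  | step x hx ih =>
    rcases (T.below_iff o hx).1 h with rfl | h
    · exact Or.inl rfl
    · right
      have := T.depth_par o hx
      rcases ih h with rfl | h'
      · omega
      · omega

theorem Below.antisymm {x y : T.V} (h : T.Below o x y) (h' : T.Below o y x) : x = y := by
  rcases h.eq_or_depth_lt with rfl | h1
  · rfl
  · rcases h'.eq_or_depth_lt with rfl | h2
    · rfl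
    · omega

theorem Below.total {x u v : T.V} (h : T.Below o x u) (h' : T.Below o x v) :
    T.Below o u v ∨ T.Below o v u := by
  induction x using T.root_induction o with
  | root =>
    rw [root_below_iff] at h h'
    rw [h, h']; exact Or.inl (T.below_refl o _)
  | step x hx ih =>
    rcases (T.below_iff o hx).1 h with rfl | h1
    · exact Or.inl h'
    · rcases (T.below_iff o hx).1 h' with rfl | h2
      · exact Or.inr h
      · exact ih h1 h2

theorem Below.par_below {x y : T.V} (h : T.Below o x y) (hne : x ≠ y) :
    T.Below o (T.par o x) y := by
  have hx : x ≠ T.leaf o := by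
    rintro rfl
    exact hne ((T.root_below_iff o).1 h).symm
  exact ((T.below_iff o hx).1 h).resolve_left (Ne.symm hne)

/-- A vertex strictly below `v` is below a child of `v`. -/
theorem Below.exists_child {x v : T.V} (h : T.Below o x v) (hne : x ≠ v) :
    ∃ c, c ≠ T.leaf o ∧ T.par o c = v ∧ T.Below o x c := by
  induction x using T.root_induction o with
  | root => exact absurd ((T.root_below_iff o).1 h).symm hne
  | step x hx ih =>
    by_cases hp : T.par o x = v
    · exact ⟨x, hx, hp, T.below_refl o _⟩
    · obtain ⟨c, h1, h2, h3⟩ := ih (h.par_below hne) hp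
      exact ⟨c, h1, h2, (T.below_par o hx).trans h3⟩

theorem children_eq {x c c' v : T.V} (hc : c ≠ T.leaf o) (hc' : c' ≠ T.leaf o)
    (h : T.par o c = v) (h' : T.par o c' = v) (hx : T.Below o x c) (hx' : T.Below o x c') :
    c = c' := by
  by_contra hne
  rcases hx.total hx' with h1 | h1
  · have := h1.par_below hne
    rw [h, ← h'] at this
    exact T.not_par_below o hc' this
  · have := h1.par_below (Ne.symm hne)
    rw [h', ← h] at this
    exact T.not_par_below o hc this

/-- Prefixing a root path with an adjacent vertex gives a root path again, unless that vertex
already lies on it. With `edge_injective` this makes the non-root vertices an index set for the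
edges. -/
theorem adj_iff {x y : T.V} :
    T.G.Adj x y ↔ (x ≠ T.leaf o ∧ T.par o x = y) ∨ (y ≠ T.leaf o ∧ T.par o y = x) := by
  constructor
  · intro h
    by_cases hxy : T.Below o y x
    · right
      have hne : y ≠ x := h.ne'
      have hy : y ≠ T.leaf o := by
        rintro rfl
        exact hne ((T.root_below_iff o).1 hxy).symm
      refine ⟨hy, ?_⟩
      have hnot : y ∉ (T.rootPath o x).support := fun h' => hne (hxy.antisymm h')
      have := T.eq_rootPath o (Walk.cons h.symm (T.rootPath o x))
        ((Walk.cons_isPath_iff _ _).2 ⟨T.rootPath_isPath o x, hnot⟩)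
      unfold par
      rw [← this]
      simp
    · left
      have hx : x ≠ T.leaf o := by
        rintro rfl
        exact hxy (T.below_root o _)
      refine ⟨hx, ?_⟩
      have := T.eq_rootPath o (Walk.cons h (T.rootPath o y))
        ((Walk.cons_isPath_iff _ _).2 ⟨T.rootPath_isPath o y, hxy⟩)
      unfold par
      rw [← this]
      simp
  · rintro (⟨h, rfl⟩ | ⟨h, rfl⟩)
    · exact T.adj_par o h
    · exact (T.adj_par o h).symm

/-- The only edge that leaves the set of vertices below `v` joins `v` to its parent. -/
theorem eq_of_adj_of_below {a b v : T.V} (h : T.G.Adj a b) (ha : T.Below o a v)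
    (hb : ¬ T.Below o b v) : a = v ∧ b = T.par o v := by
  rcases (adj_iff (o := o)).1 h with ⟨h1, rfl⟩ | ⟨h1, rfl⟩
  · by_cases e : a = v
    · exact ⟨e, e ▸ rfl⟩
    · exact absurd (ha.par_below e) hb
  · exact absurd ((T.below_par o h1).trans ha) hb

theorem edge_injective {u v : T.V} (hu : u ≠ T.leaf o) (hv : v ≠ T.leaf o)
    (h : s(u, T.par o u) = s(v, T.par o v)) : u = v := by
  rcases Sym2.eq_iff.1 h with ⟨h, -⟩ | ⟨h1, h2⟩
  · exact h
  · have h3 := T.below_par o hu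
    have h4 := T.below_par o hv
    rw [h2] at h3
    rw [← h1] at h4
    exact h3.antisymm h4

theorem reachable_of_below {v x : T.V} (hx : T.Below o x v) :
    (T.G.induce {z | T.Below o z v}).Reachable ⟨x, hx⟩ ⟨v, T.below_refl o v⟩ := by
  induction x using T.root_induction o with
  | root =>
    have := (T.root_below_iff o).1 hx
    subst this
    rfl
  | step x hx' ih =>
    by_cases e : x = v
    · subst e; rfl
    · have h := hx.par_below e
      refine Reachable.trans (Adj.reachable ?_) (ih h)
      simpa using T.adj_par o hx'

theorem reachable_of_not_below {v x : T.V} (hv : v ≠ T.leaf o) (hx : ¬ T.Below o x v) :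
    (T.G.induce {z | ¬ T.Below o z v}).Reachable ⟨x, hx⟩
      ⟨T.leaf o, fun h => hv ((T.root_below_iff o).1 h)⟩ := by
  induction x using T.root_induction o with
  | root => rfl
  | step x hx' ih =>
    have h : ¬ T.Below o (T.par o x) v := fun h => hx ((T.below_par o hx').trans h)
    refine Reachable.trans (Adj.reachable ?_) (ih h)
    simpa using T.adj_par o hx'

theorem reachable_mono_induce {s : Set T.V} {K : SimpleGraph T.V} {x y : s}
    (hK : ∀ a ∈ s, ∀ b ∈ s, T.G.Adj a b → K.Adj a b)
    (h : (T.G.induce s).Reachable x y) : K.Reachable x y := by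
  let φ : T.G.induce s →g K := ⟨fun z => z.1, fun {a b} hab => hK a a.2 b b.2 (by simpa using hab)⟩
  exact h.map φ

theorem exists_crossing {W : Type*} {K : SimpleGraph W} {x y : W} (h : K.Reachable x y)
    (p : W → Prop) (hx : p x) (hy : ¬ p y) : ∃ a b, K.Adj a b ∧ p a ∧ ¬ p b := by
  obtain ⟨q⟩ := h
  obtain ⟨d, -, h1, h2⟩ := q.exists_boundary_dart {z | p z} hx hy
  exact ⟨_, _, d.adj, h1, h2⟩

/-- The vertices below `v` are connected without the edge above `v`, and that edge is the only way
out of them. -/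
theorem reachable_deleteEdges_iff {v x : T.V} (hv : v ≠ T.leaf o) :
    (T.G.deleteEdges {s(v, T.par o v)}).Reachable v x ↔ T.Below o x v := by
  constructor
  · intro h
    by_contra hx
    obtain ⟨a, b, hab, ha, hb⟩ := exists_crossing h (fun z => T.Below o z v) (T.below_refl o v) hx
    rw [deleteEdges_adj] at hab
    obtain ⟨rfl, rfl⟩ := eq_of_adj_of_below hab.1 ha hb
    exact hab.2 rfl
  · intro h
    refine (reachable_mono_induce ?_ (reachable_of_below h)).symm
    intro a ha b hb hab
    rw [deleteEdges_adj]
    refine ⟨hab, fun e => ?_⟩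
    have hp := T.not_par_below o hv
    rcases Sym2.eq_iff.1 (Set.mem_singleton_iff.1 e) with ⟨h1, h2⟩ | ⟨h1, h2⟩
    · exact hp (h2 ▸ hb)
    · exact hp (h1 ▸ ha)

theorem reachable_deleteEdges_par_iff {v x : T.V} (hv : v ≠ T.leaf o) :
    (T.G.deleteEdges {s(v, T.par o v)}).Reachable (T.par o v) x ↔ ¬ T.Below o x v := by
  constructor
  · intro h hx
    obtain ⟨a, b, hab, ha, hb⟩ := exists_crossing h.symm (fun z => T.Below o z v) hx
      (T.not_par_below o hv)
    rw [deleteEdges_adj] at hab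
    obtain ⟨rfl, rfl⟩ := eq_of_adj_of_below hab.1 ha hb
    exact hab.2 rfl
  · intro h
    have key : ∀ a ∈ {z | ¬ T.Below o z v}, ∀ b ∈ {z | ¬ T.Below o z v}, T.G.Adj a b →
        (T.G.deleteEdges {s(v, T.par o v)}).Adj a b := by
      intro a ha b hb hab
      rw [deleteEdges_adj]
      refine ⟨hab, fun e => ?_⟩
      rcases Sym2.eq_iff.1 (Set.mem_singleton_iff.1 e) with ⟨h1, h2⟩ | ⟨h1, h2⟩
      · exact ha (h1 ▸ T.below_refl o _)
      · exact hb (h2 ▸ T.below_refl o _)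
    exact (reachable_mono_induce key (reachable_of_not_below hv (T.not_par_below o hv))).trans
      (reachable_mono_induce key (reachable_of_not_below hv h)).symm

/-- If `S` lies on one side of the edge, that side is a connected subgraph which contains `S` and
avoids the edge. If `S` meets both sides, every connected subgraph containing `S` must cross, and
this edge is the only crossing. -/
theorem minSubtree_adj_par_iff {v : T.V} (hv : v ≠ T.leaf o) {S : Set T.V} :
    (T.minSubtree S).Adj v (T.par o v) ↔
      (∃ x ∈ S, T.Below o x v) ∧ ∃ x ∈ S, ¬ T.Below o x v := by
  unfold minSubtree
  rw [Subgraph.sInf_adj]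
  constructor
  · rintro ⟨h, -⟩
    constructor
    · by_contra! hS
      have hconn : ((⊤ : T.G.Subgraph).induce {z | ¬ T.Below o z v}).Connected := by
        rw [← connected_induce_iff]
        have : Nonempty {z | ¬ T.Below o z v} := ⟨⟨_, T.not_par_below o hv⟩⟩
        exact ⟨fun x y => (reachable_of_not_below hv x.2).trans (reachable_of_not_below hv y.2).symm⟩
      have := h _ ⟨hconn, fun x hx => hS x hx⟩
      simp [T.below_refl o v] at this
    · by_contra! hS
      have hconn : ((⊤ : T.G.Subgraph).induce {z | T.Below o z v}).Connected := by
        rw [← connected_induce_iff]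
        have : Nonempty {z | T.Below o z v} := ⟨⟨_, T.below_refl o v⟩⟩
        exact ⟨fun x y => (reachable_of_below x.2).trans (reachable_of_below y.2).symm⟩
      have := h _ ⟨hconn, fun x hx => hS x hx⟩
      simp [T.not_par_below o hv] at this
  · rintro ⟨⟨x, hx, hxv⟩, y, hy, hyv⟩
    refine ⟨fun H hH => ?_, T.adj_par o hv⟩
    obtain ⟨a, b, hab, ha, hb⟩ := exists_crossing
      (hH.1.coe.preconnected ⟨x, hH.2 hx⟩ ⟨y, hH.2 hy⟩) (fun z => T.Below o z.1 v) hxv hyv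
    obtain ⟨h1, h2⟩ := eq_of_adj_of_below (Subgraph.coe_adj_sub _ _ _ hab) ha hb
    rw [Subgraph.coe_adj, h1, h2] at hab
    exact hab

/-! ### Clusters and split weights -/

variable (T o)

/-- The labels of the leaves below a vertex. -/
noncomputable def cluster (v : T.V) : Finset (Fin n) :=
  univ.filter fun i => T.Below o (T.leaf i) v

/-- The weight of the edge from a vertex to its parent. -/
noncomputable def parWeight (v : T.V) : ℝ := T.w s(v, T.par o v)

/-- The sum of the weights of the edges that cut off the cluster `A` from the root. -/
noncomputable def splitWeight (A : Finset (Fin n)) : ℝ :=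
  ∑ v with v ≠ T.leaf o ∧ T.cluster o v = A, T.parWeight o v

variable {T o}

@[simp] theorem mem_cluster {v : T.V} {i : Fin n} :
    i ∈ T.cluster o v ↔ T.Below o (T.leaf i) v := by simp [cluster]

theorem weight_eq_sum (H : T.G.Subgraph) :
    T.weight H = ∑ v with v ≠ T.leaf o ∧ H.Adj v (T.par o v), T.parWeight o v := by
  unfold weight parWeight
  symm
  refine sum_bij (fun v _ => s(v, T.par o v)) ?_ ?_ ?_ ?_
  · intro v hv
    simpa using (mem_filter.1 hv).2.2
  · intro u hu v hv h
    exact edge_injective (mem_filter.1 hu).2.1 (mem_filter.1 hv).2.1 h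
  · intro e
    induction e using Sym2.ind with
    | _ x y =>
      intro h
      have h' : H.Adj x y := by simpa using h
      rcases (adj_iff (o := o)).1 h'.adj_sub with ⟨h1, rfl⟩ | ⟨h1, rfl⟩
      · exact ⟨x, by simp [h1, h'], rfl⟩
      · exact ⟨y, by simp [h1, h'.symm], Sym2.eq_swap⟩
  · intros; rfl

theorem multiweight_eq_sum (I : Finset (Fin n)) :
    T.multiweight I = ∑ A with (∃ i ∈ I, i ∈ A) ∧ ∃ i ∈ I, i ∉ A, T.splitWeight o A := by
  unfold multiweight splitWeight
  rw [weight_eq_sum (o := o), ← sum_fiberwise_of_maps_to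
    (t := univ.filter fun A : Finset (Fin n) => (∃ i ∈ I, i ∈ A) ∧ ∃ i ∈ I, i ∉ A)
    (g := T.cluster o)]
  · refine sum_congr rfl fun A hA => sum_congr ?_ fun _ _ => rfl
    ext v
    simp only [mem_filter, mem_univ, true_and] at hA ⊢
    constructor
    · rintro ⟨⟨h1, h2⟩, h3⟩
      exact ⟨h1, h3⟩
    · rintro ⟨h1, rfl⟩
      refine ⟨⟨h1, (minSubtree_adj_par_iff h1).2 ?_⟩, rfl⟩
      simpa using hA
  · intro v hv
    simp only [mem_filter, mem_univ, true_and] at hv ⊢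
    simpa using (minSubtree_adj_par_iff hv.1).1 hv.2

theorem totalWeight_eq_sum : T.totalWeight = ∑ A, T.splitWeight o A := by
  unfold totalWeight splitWeight
  rw [weight_eq_sum (o := o), ← sum_fiberwise (g := T.cluster o)]
  refine sum_congr rfl fun A hA => sum_congr ?_ fun _ _ => rfl
  ext v
  simp only [mem_filter, mem_univ, true_and, Subgraph.top_adj]
  constructor
  · rintro ⟨⟨h1, h2⟩, h3⟩
    exact ⟨h1, h3⟩
  · rintro ⟨h1, rfl⟩
    exact ⟨⟨h1, T.adj_par o h1⟩, rfl⟩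

theorem side_par {v : T.V} (hv : v ≠ T.leaf o) :
    T.side v (T.par o v) = (T.cluster o v : Set (Fin n)) := by
  ext i
  simp [side, reachable_deleteEdges_iff hv]

theorem side_par_swap {v : T.V} (hv : v ≠ T.leaf o) :
    T.side (T.par o v) v = ((T.cluster o v)ᶜ : Finset (Fin n)) := by
  ext i
  rw [side, Sym2.eq_swap]
  simp [reachable_deleteEdges_par_iff hv]

theorem cluster_root : T.cluster o (T.leaf o) = univ := by
  ext; simp [T.below_root o]

theorem not_mem_cluster {v : T.V} (hv : v ≠ T.leaf o) : o ∉ T.cluster o v := by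
  rw [mem_cluster, root_below_iff]; exact hv

theorem cluster_mono {u v : T.V} (h : T.Below o u v) : T.cluster o u ⊆ T.cluster o v :=
  fun i hi => mem_cluster.2 ((mem_cluster.1 hi).trans h)

theorem cluster_laminar (u v : T.V) : Disjoint (T.cluster o u) (T.cluster o v) ∨
    T.cluster o u ⊆ T.cluster o v ∨ T.cluster o v ⊆ T.cluster o u := by
  by_cases h : Disjoint (T.cluster o u) (T.cluster o v)
  · exact Or.inl h
  · obtain ⟨i, hi, hi'⟩ := not_disjoint_iff.1 h
    right
    exact ((mem_cluster.1 hi).total (mem_cluster.1 hi')).imp cluster_mono cluster_mono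

end LeafLabelledTree

/-! ### Laminar weights and their sums over the sets containing a pair -/

namespace SetWeight

open Finset
open scoped Classical

variable {α : Type*}

/-- The sets where `f` does not vanish are pairwise nested or disjoint. -/
def Laminar (f : Finset α → ℝ) : Prop :=
  ∀ A B, f A ≠ 0 → f B ≠ 0 → Disjoint A B ∨ A ⊆ B ∨ B ⊆ A

variable [Fintype α]

/-- If `g A < f A` while `f = g` above `A`, then for any two elements of `A` the equal pair sums
force `g` to be positive on some set that contains both but not all of `A`. Laminarity of `g`
forbids this for all pairs at once. No sign is required at `X`, so that an additive constant can be
absorbed there. -/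
theorem laminar_le_of_pair_sums_eq {X A : Finset α} {f g : Finset α → ℝ}
    (hfX : ∀ A, f A ≠ 0 → A ⊆ X) (hgX : ∀ A, g A ≠ 0 → A ⊆ X)
    (hf : ∀ A, A ≠ X → 0 ≤ f A) (hg : ∀ A, A ≠ X → 0 ≤ g A) (hgl : Laminar g)
    (h : ∀ i ∈ X, ∀ j ∈ X, i ≠ j →
      ∑ B with i ∈ B ∧ j ∈ B, f B = ∑ B with i ∈ B ∧ j ∈ B, g B)
    (hA : 2 ≤ #A) (hsup : ∀ B, A ⊂ B → f B = g B) : f A ≤ g A := by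
  by_contra! hlt
  have hAX : A ⊆ X := by
    by_cases e : A = X
    · exact e.subset
    · exact hfX A ((hg A e).trans_lt hlt).ne'
  have key : ∀ i ∈ A, ∀ j ∈ A, i ≠ j → ∃ B, i ∈ B ∧ j ∈ B ∧ ¬ A ⊆ B ∧ 0 < g B := by
    intro i hi j hj hij
    by_contra! hno
    have h0 := h i (hAX hi) j (hAX hj) hij
    have hsub : (univ.filter fun B => A ⊆ B) ⊆ univ.filter fun B => i ∈ B ∧ j ∈ B := by
      intro B hB
      simp only [mem_filter, mem_univ, true_and] at hB ⊢
      exact ⟨hB hi, hB hj⟩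
    have h1 : ∑ B with A ⊆ B, f B ≤ ∑ B with i ∈ B ∧ j ∈ B, f B := by
      refine sum_le_sum_of_subset_of_nonneg hsub fun B _ hB => hf B ?_
      rintro rfl
      simp [hAX] at hB
    have h2 : ∑ B with i ∈ B ∧ j ∈ B, g B ≤ ∑ B with A ⊆ B, g B := by
      rw [← sum_sdiff hsub]
      have : ∑ B ∈ (univ.filter fun B => i ∈ B ∧ j ∈ B) \ (univ.filter fun B => A ⊆ B), g B ≤ 0 := by
        refine sum_nonpos fun B hB => ?_
        simp only [mem_sdiff, mem_filter, mem_univ, true_and] at hB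
        exact hno B hB.1.1 hB.1.2 hB.2
      linarith
    have h3 : ∑ B with A ⊆ B, g B < ∑ B with A ⊆ B, f B := by
      refine sum_lt_sum (fun B hB => ?_) ⟨A, by simp, hlt⟩
      simp only [mem_filter, mem_univ, true_and] at hB
      rcases hB.eq_or_ssubset with rfl | hB
      · exact hlt.le
      · exact (hsup B hB).ge
    linarith
  obtain ⟨i, hi, j, hj, hij⟩ := one_lt_card.1 (by omega : 1 < #A)
  obtain ⟨B₀, h1, -, h2, h3⟩ := key i hi j hj hij
  -- A largest such set `B` through `i` misses some `l` in `A`. A set for the pair `i`, `l` meets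
  -- `B` in `i` and is not inside `B`, so it contains `B` strictly or violates laminarity.
  obtain ⟨B, hB, hmax⟩ := exists_max_image
    (univ.filter fun B : Finset α => i ∈ B ∧ ¬ A ⊆ B ∧ 0 < g B) card ⟨B₀, by simp [h1, h2, h3]⟩
  simp only [mem_filter, mem_univ, true_and] at hB hmax
  obtain ⟨l, hl, hlB⟩ := not_subset.1 hB.2.1
  obtain ⟨B', h1, h2, h3, h4⟩ := key i hi l hl (by rintro rfl; exact hlB hB.1)
  have hcard := hmax B' ⟨h1, h3, h4⟩
  rcases hgl B B' hB.2.2.ne' h4.ne' with hd | hd | hd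
  · exact disjoint_left.1 hd hB.1 h1
  · exact absurd (card_lt_card (hd.ssubset_of_ne (by rintro rfl; exact hlB h2))) (by omega)
  · exact hlB (hd h2)

/-- Downward induction on `A`, with the inequality applied both ways. Singletons are out of reach,
as no pair sees them. -/
theorem laminar_eq_of_pair_sums_eq {X : Finset α} {f g : Finset α → ℝ}
    (hfX : ∀ A, f A ≠ 0 → A ⊆ X) (hgX : ∀ A, g A ≠ 0 → A ⊆ X)
    (hf : ∀ A, A ≠ X → 0 ≤ f A) (hg : ∀ A, A ≠ X → 0 ≤ g A) (hfl : Laminar f) (hgl : Laminar g)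
    (h : ∀ i ∈ X, ∀ j ∈ X, i ≠ j →
      ∑ B with i ∈ B ∧ j ∈ B, f B = ∑ B with i ∈ B ∧ j ∈ B, g B)
    (A : Finset α) (hA : 2 ≤ #A) : f A = g A := by
  induction A using Finset.strongDownwardInduction (n := Fintype.card α) with
  | H A ih =>
    have hsup : ∀ B, A ⊂ B → f B = g B := fun B hB =>
      ih (card_le_univ B) hB (hA.trans (card_le_card hB.1))
    exact le_antisymm
      (laminar_le_of_pair_sums_eq hfX hgX hf hg hgl h hA hsup)
      (laminar_le_of_pair_sums_eq hgX hfX hg hf hfl (fun i hi j hj e => (h i hi j hj e).symm) hA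
        fun B hB => (hsup B hB).symm)
  | _ => exact card_le_univ A

/-! ### Averaging over the `k`-sets through a pair -/

/-- The set `A` divides the set `I` into two nonempty parts. -/
def Separates (A I : Finset α) : Prop := (∃ i ∈ I, i ∈ A) ∧ ∃ i ∈ I, i ∉ A

/-- The sum of the weights of the sets that divide `I`. -/
noncomputable def sepSum (f : Finset α → ℝ) (I : Finset α) : ℝ :=
  ∑ A with Separates A I, f A

theorem card_powersetCard_between {k : ℕ} (hk : 2 ≤ k) {A : Finset α} {i j : α} (hij : i ≠ j)
    (hi : i ∈ A) (hj : j ∈ A) :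
    #{I ∈ powersetCard k (univ : Finset α) | (i ∈ I ∧ j ∈ I) ∧ I ⊆ A} =
      (#A - 2).choose (k - 2) := by
  have hc : #(A \ {i, j}) = #A - 2 := by
    rw [card_sdiff_of_subset (by simp [insert_subset_iff, hi, hj]), card_pair hij]
  rw [← hc, ← card_powersetCard]
  symm
  refine card_bij' (fun J _ => J ∪ {i, j}) (fun I _ => I \ {i, j}) ?_ ?_ ?_ ?_
  · intro J hJ
    rw [mem_powersetCard] at hJ
    have hd : Disjoint J {i, j} := disjoint_of_subset_left hJ.1 sdiff_disjoint
    have h2 : #(J ∪ {i, j}) = k := by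
      rw [card_union_of_disjoint hd, card_pair hij]; omega
    have h3 : J ∪ {i, j} ⊆ A :=
      union_subset (hJ.1.trans sdiff_subset) (by simp [insert_subset_iff, hi, hj])
    rw [mem_filter, mem_powersetCard]
    exact ⟨⟨subset_univ _, h2⟩, by simp, h3⟩
  · intro I hI
    simp only [mem_filter, mem_powersetCard, subset_univ, true_and] at hI
    rw [mem_powersetCard, card_sdiff_of_subset (by simp [insert_subset_iff, hI.2.1]), card_pair hij]
    exact ⟨sdiff_subset_sdiff hI.2.2 le_rfl, by omega⟩
  · intro J hJ
    rw [mem_powersetCard] at hJ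
    have hd : Disjoint J {i, j} := disjoint_of_subset_left hJ.1 sdiff_disjoint
    exact union_sdiff_cancel_right hd
  · intro I hI
    simp only [mem_filter, mem_powersetCard, subset_univ, true_and] at hI
    exact sdiff_union_of_subset (by simp [insert_subset_iff, hI.2.1])

/-- A `k`-set through `i` and `j` fails to be separated exactly when it lies inside `A` or inside
the complement, and which of these can occur is decided by the position of `i` and `j`. -/
theorem card_separated {k : ℕ} (hk : 2 ≤ k) (A : Finset α) {i j : α} (hij : i ≠ j) :
    (#{I ∈ powersetCard k (univ : Finset α) | (i ∈ I ∧ j ∈ I) ∧ Separates A I} : ℝ) =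
      ((Fintype.card α - 2).choose (k - 2) : ℕ)
        - (if i ∈ A ∧ j ∈ A then (((#A - 2).choose (k - 2) : ℕ) : ℝ) else 0)
        - (if i ∉ A ∧ j ∉ A then (((#Aᶜ - 2).choose (k - 2) : ℕ) : ℝ) else 0) := by
  have hN := card_powersetCard_between hk hij (mem_univ i) (mem_univ j)
  simp only [subset_univ, and_true, card_univ] at hN
  have hsplit := card_filter_add_card_filter_not
    (s := {I ∈ powersetCard k (univ : Finset α) | i ∈ I ∧ j ∈ I}) (fun I => Separates A I)
  rw [hN, filter_filter, filter_filter] at hsplit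
  by_cases hi : i ∈ A <;> by_cases hj : j ∈ A
  · have := card_powersetCard_between hk hij hi hj
    have e : {I ∈ powersetCard k (univ : Finset α) | (i ∈ I ∧ j ∈ I) ∧ ¬ Separates A I} =
        {I ∈ powersetCard k (univ : Finset α) | (i ∈ I ∧ j ∈ I) ∧ I ⊆ A} := by
      refine filter_congr fun I _ => and_congr_right fun h => ?_
      unfold Separates
      constructor
      · intro h' x hx
        by_contra hxA
        exact h' ⟨⟨i, h.1, hi⟩, x, hx, hxA⟩
      · rintro h' ⟨-, x, hx, hxA⟩
        exact hxA (h' hx)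
    rw [e, this] at hsplit
    simp only [hi, hj, and_self, if_true, not_true, if_false, sub_zero]
    rw [← hsplit]; push_cast; ring
  · have e : {I ∈ powersetCard k (univ : Finset α) | (i ∈ I ∧ j ∈ I) ∧ ¬ Separates A I} = ∅ := by
      refine filter_eq_empty_iff.2 fun I _ h => h.2 ⟨⟨i, h.1.1, hi⟩, j, h.1.2, hj⟩
    rw [e] at hsplit
    simp [hi, hj, ← hsplit]
  · have e : {I ∈ powersetCard k (univ : Finset α) | (i ∈ I ∧ j ∈ I) ∧ ¬ Separates A I} = ∅ := by
      refine filter_eq_empty_iff.2 fun I _ h => h.2 ⟨⟨j, h.1.2, hj⟩, i, h.1.1, hi⟩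
    rw [e] at hsplit
    simp [hi, hj, ← hsplit]
  · have := card_powersetCard_between hk hij (mem_compl.2 hi) (mem_compl.2 hj)
    have e : {I ∈ powersetCard k (univ : Finset α) | (i ∈ I ∧ j ∈ I) ∧ ¬ Separates A I} =
        {I ∈ powersetCard k (univ : Finset α) | (i ∈ I ∧ j ∈ I) ∧ I ⊆ Aᶜ} := by
      refine filter_congr fun I _ => and_congr_right fun h => ?_
      unfold Separates
      constructor
      · intro h' x hx
        rw [mem_compl]
        intro hxA
        exact h' ⟨⟨x, hx, hxA⟩, i, h.1, hi⟩
      · rintro h' ⟨⟨x, hx, hxA⟩, -⟩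
        exact mem_compl.1 (h' hx) hxA
    rw [e, this] at hsplit
    simp only [hi, hj, and_self, if_true, not_true, if_false, sub_zero, not_false_eq_true]
    rw [← hsplit]; push_cast; ring

/-- The sum of `sepSum f` over the `k`-sets that contain two given elements. -/
noncomputable def pairSum (k : ℕ) (f : Finset α → ℝ) (i j : α) : ℝ :=
  ∑ I ∈ powersetCard k (univ : Finset α) with i ∈ I ∧ j ∈ I, sepSum f I

theorem pairSum_eq {k : ℕ} (hk : 2 ≤ k) (f : Finset α → ℝ) {i j : α} (hij : i ≠ j) :
    pairSum k f i j = ∑ A, f A * (((Fintype.card α - 2).choose (k - 2) : ℕ)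
        - (if i ∈ A ∧ j ∈ A then (((#A - 2).choose (k - 2) : ℕ) : ℝ) else 0)
        - (if i ∉ A ∧ j ∉ A then (((#Aᶜ - 2).choose (k - 2) : ℕ) : ℝ) else 0)) := by
  unfold pairSum sepSum
  simp_rw [← card_separated hk _ hij, sum_filter, card_filter]
  push_cast
  simp_rw [mul_sum]
  rw [sum_comm]
  refine sum_congr rfl fun I _ => ?_
  split_ifs with h
  · refine sum_congr rfl fun A _ => ?_
    simp [h]
  · symm
    refine sum_eq_zero fun A _ => ?_
    simp [h]

/-- The factor of the weight of `A` in the tree metric obtained by averaging. -/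
noncomputable def pairFactor (k : ℕ) (A : Finset α) : ℝ :=
  ((#A - 2).choose (k - 2) : ℕ) + ((#Aᶜ - 2).choose (k - 2) : ℕ)

/-- This is the Gromov product of `i` and `j` at `o`: up to a constant independent of the pair, only
the sets containing both contribute. Every `A` in the support misses `o`, so its coefficient can be
checked in the four positions of `i` and `j`. -/
theorem pairSum_triangle {k : ℕ} (hk : 2 ≤ k) {o : α} {f : Finset α → ℝ}
    (hf : ∀ A, f A ≠ 0 → o ∉ A) {i j : α} (hij : i ≠ j) (hi : i ≠ o) (hj : j ≠ o) :
    pairSum k f i o + pairSum k f j o - pairSum k f i j =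
      ∑ A, f A * (((Fintype.card α - 2).choose (k - 2) : ℕ) - ((#Aᶜ - 2).choose (k - 2) : ℕ)) +
      ∑ A with i ∈ A ∧ j ∈ A, f A * pairFactor k A := by
  rw [pairSum_eq hk f hi, pairSum_eq hk f hj, pairSum_eq hk f hij, sum_filter,
    ← sum_add_distrib, ← sum_sub_distrib, ← sum_add_distrib]
  refine sum_congr rfl fun A _ => ?_
  by_cases h0 : f A = 0
  · simp [h0]
  · have ho := hf A h0
    unfold pairFactor
    by_cases h1 : i ∈ A <;> by_cases h2 : j ∈ A <;> simp [ho, h1, h2] <;> ring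

/-! ### Uniqueness of the laminar weight without bad splits -/

/-- The properties of the function that assigns to a set of labels the weight of the edge that
separates it from the label `o`. -/
structure IsClusterWeight (o : α) (f : Finset α → ℝ) : Prop where
  nonneg : ∀ A, 0 ≤ f A
  not_mem : ∀ A, f A ≠ 0 → o ∉ A
  empty : f ∅ = 0
  laminar : Laminar f

/-- The set of the labels that the edge at the leaf with label `i` separates from `o`. -/
noncomputable def pendant (o i : α) : Finset α := if i = o then univ.erase o else {i}

theorem pendant_ne_empty (hn : 3 ≤ Fintype.card α) (o i : α) : pendant o i ≠ ∅ := by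
  unfold pendant
  split_ifs with h
  · rw [← card_pos.trans nonempty_iff_ne_empty, card_erase_of_mem (mem_univ o), card_univ]
    omega
  · simp

theorem pendant_injective (hn : 3 ≤ Fintype.card α) (o : α) :
    Function.Injective (pendant o : α → Finset α) := by
  have hc : #(univ.erase o) = Fintype.card α - 1 := by
    rw [card_erase_of_mem (mem_univ o), card_univ]
  intro i j h
  unfold pendant at h
  split_ifs at h with h1 h2 h2
  · rw [h1, h2]
  · rw [h, card_singleton] at hc; omega
  · rw [← h, card_singleton] at hc; omega
  · exact singleton_injective h

theorem separates_pendant_iff {I : Finset α} (hI : 2 ≤ #I) (o i : α) :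
    Separates (pendant o i) I ↔ i ∈ I := by
  unfold Separates pendant
  split_ifs with h
  · subst h
    simp only [mem_erase, mem_univ, and_true, not_not, exists_eq_right]
    refine ⟨fun h => h.2, fun h => ⟨?_, h⟩⟩
    exact exists_mem_ne (by omega) i
  · simp only [mem_singleton, exists_eq_right]
    exact ⟨fun h => h.1, fun h => ⟨h, exists_mem_ne (by omega) i⟩⟩

theorem exists_eq_pendant {o : α} {A : Finset α} (hA : A ≠ ∅) (ho : o ∉ A)
    (h : ¬ (2 ≤ #A ∧ A ≠ univ.erase o)) : ∃ i, A = pendant o i := by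
  by_cases h2 : 2 ≤ #A
  · exact ⟨o, by simp [pendant, not_not.1 (not_and.1 h h2)]⟩
  · have : 0 < #A := card_pos.2 (nonempty_iff_ne_empty.2 hA)
    obtain ⟨i, rfl⟩ := card_eq_one.1 (by omega : #A = 1)
    refine ⟨i, ?_⟩
    have : i ≠ o := by rintro rfl; simp at ho
    simp [pendant, this]

/-- The larger of the two parts cut off by `A` has at least `k` elements. -/
def Good (k : ℕ) (A : Finset α) : Prop := k ≤ #A ∨ k ≤ #Aᶜ

theorem good_pendant {k : ℕ} (hkn : k + 1 ≤ Fintype.card α) (o i : α) : Good k (pendant o i) := by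
  unfold Good pendant
  split_ifs with h
  · left
    rw [card_erase_of_mem (mem_univ o), card_univ]; omega
  · right
    rw [card_compl, card_singleton]; omega

theorem separates_of_not_good {k : ℕ} {A I : Finset α} (hA : ¬ Good k A) (hI : #I = k) :
    Separates A I := by
  unfold Good at hA
  push Not at hA
  unfold Separates
  constructor
  · by_contra! h
    have : I ⊆ Aᶜ := fun x hx => mem_compl.2 (h x hx)
    have := card_le_card this
    omega
  · by_contra! h
    have : I ⊆ A := fun x hx => h x hx
    have := card_le_card this
    omega

/-- Two `k`-sets that differ by exchanging one element have the same sum, so `t` is constant. -/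
theorem eq_zero_of_sums_eq_zero {k : ℕ} (hk : 1 ≤ k) (hkn : k + 1 ≤ Fintype.card α) {t : α → ℝ}
    (h : ∀ I : Finset α, #I = k → ∑ i ∈ I, t i = 0) (i : α) : t i = 0 := by
  have hconst : ∀ j, t j = t i := by
    intro j
    by_cases hij : j = i
    · rw [hij]
    -- Room for a common part of size `k - 1` that avoids both elements; this is where `k < n`
    -- enters.
    have hc : k - 1 ≤ #((univ.erase i).erase j) := by
      rw [card_erase_of_mem (by simp [hij]), card_erase_of_mem (mem_univ i), card_univ]; omega
    obtain ⟨R, hR, hRc⟩ := exists_subset_card_eq hc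
    have h1 : i ∉ R := fun h => by simpa using hR h
    have h2 : j ∉ R := fun h => by simpa using hR h
    have e1 := h (insert i R) (by rw [card_insert_of_notMem h1]; omega)
    have e2 := h (insert j R) (by rw [card_insert_of_notMem h2]; omega)
    rw [sum_insert h1] at e1
    rw [sum_insert h2] at e2
    linarith
  obtain ⟨I, -, hI⟩ := exists_subset_card_eq (s := (univ : Finset α)) (n := k)
    (by rw [card_univ]; omega)
  have := h I hI
  rw [sum_congr rfl fun j _ => hconst j, sum_const, hI, nsmul_eq_mul] at this
  have hk' : (k : ℝ) ≠ 0 := by positivity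
  exact (mul_eq_zero.1 this).resolve_left hk'

theorem pairFactor_nonneg (k : ℕ) (A : Finset α) : 0 ≤ pairFactor k A := by
  unfold pairFactor; positivity

theorem pairFactor_pos {k : ℕ} {A : Finset α} (h : Good k A) : 0 < pairFactor k A := by
  unfold pairFactor
  rcases h with h | h
  · have : 0 < (#A - 2).choose (k - 2) := Nat.choose_pos (by omega)
    positivity
  · have : 0 < (#Aᶜ - 2).choose (k - 2) := Nat.choose_pos (by omega)
    positivity

/-- A laminar weight supported on the sets that cut off a part with at least `k` elements is
determined by its `k`-weights. -/
theorem eq_of_sepSum_eq {k : ℕ} (hk : 2 ≤ k) (hkn : k + 1 ≤ Fintype.card α) {o : α}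
    {f g : Finset α → ℝ} (hf : IsClusterWeight o f) (hg : IsClusterWeight o g)
    (hfk : ∀ A, f A ≠ 0 → Good k A) (hgk : ∀ A, g A ≠ 0 → Good k A)
    (h : ∀ I : Finset α, #I = k → sepSum f I = sepSum g I) : f = g := by
  set X : Finset α := univ.erase o with hX
  -- `K` is the constant in the Gromov products. It enters the pair sums of `F` as extra weight on
  -- `X`, which contains every pair of labels other than `o`.
  let K : (Finset α → ℝ) → ℝ := fun f =>
    ∑ A, f A * (((Fintype.card α - 2).choose (k - 2) : ℕ) - ((#Aᶜ - 2).choose (k - 2) : ℕ))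
  let F : (Finset α → ℝ) → Finset α → ℝ := fun f A =>
    f A * pairFactor k A + if A = X then K f else 0
  have hFX : ∀ f : Finset α → ℝ, IsClusterWeight o f → ∀ A, F f A ≠ 0 → A ⊆ X := by
    intro f hf A hA
    by_cases e : A = X
    · exact e.subset
    · have : f A ≠ 0 := by rintro e'; simp [F, e, e'] at hA
      intro x hx
      simp only [hX, mem_erase, mem_univ, and_true]
      rintro rfl
      exact hf.not_mem A this hx
  have hFn : ∀ f : Finset α → ℝ, IsClusterWeight o f → ∀ A, A ≠ X → 0 ≤ F f A := by
    intro f hf A hA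
    simp only [F, hA, if_false, add_zero]
    exact mul_nonneg (hf.nonneg A) (pairFactor_nonneg k A)
  have hFl : ∀ f : Finset α → ℝ, IsClusterWeight o f → Laminar (F f) := by
    intro f hf A B hA hB
    by_cases e : A = X
    · right; right; rw [e]; exact hFX f hf B hB
    by_cases e' : B = X
    · right; left; rw [e']; exact hFX f hf A hA
    refine hf.laminar A B ?_ ?_
    · rintro h; simp [F, e, h] at hA
    · rintro h; simp [F, e', h] at hB
  have hFs : ∀ f : Finset α → ℝ, IsClusterWeight o f → ∀ i ∈ X, ∀ j ∈ X, i ≠ j →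
      ∑ B with i ∈ B ∧ j ∈ B, F f B = pairSum k f i o + pairSum k f j o - pairSum k f i j := by
    intro f hf i hi j hj hij
    rw [pairSum_triangle hk hf.not_mem hij (mem_erase.1 hi).1 (mem_erase.1 hj).1]
    simp only [F]
    rw [sum_add_distrib, sum_ite_eq' _ X, if_pos (by simp [hi, hj])]
    ring
  have hpair : ∀ i j, pairSum k f i j = pairSum k g i j := by
    intro i j
    refine sum_congr rfl fun I hI => h I ?_
    exact (mem_powersetCard.1 (mem_filter.1 hI).1).2
  have hFG := laminar_eq_of_pair_sums_eq (hFX f hf) (hFX g hg) (hFn f hf) (hFn g hg)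
    (hFl f hf) (hFl g hg) (fun i hi j hj hij => by
      rw [hFs f hf i hi j hj hij, hFs g hg i hi j hj hij, hpair, hpair, hpair])
  have hbig : ∀ A, 2 ≤ #A ∧ A ≠ X → f A = g A := by
    rintro A ⟨h2, hne⟩
    have := hFG A h2
    simp only [F, hne, if_false, add_zero] at this
    by_cases hA : Good k A
    · exact mul_right_cancel₀ (pairFactor_pos hA).ne' this
    · have h1 : f A = 0 := by_contra fun e => hA (hfk A e)
      have h2 : g A = 0 := by_contra fun e => hA (hgk A e)
      rw [h1, h2]
  have hn : 3 ≤ Fintype.card α := by omega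
  -- Once the other sets agree, only the pendant splits remain in the difference of the `k`-weights
  -- of `I`, one for each label in `I`.
  have hpend : ∀ i, f (pendant o i) - g (pendant o i) = 0 := by
    refine eq_zero_of_sums_eq_zero (by omega) hkn fun I hI => ?_
    have h0 := h I hI
    rw [← sub_eq_zero, sepSum, sepSum, ← sum_sub_distrib] at h0
    rw [← h0]
    have : ∑ i ∈ I, (f (pendant o i) - g (pendant o i)) =
        ∑ A ∈ I.image (pendant o), (f A - g A) :=
      (sum_image (f := fun A => f A - g A) fun _ _ _ _ e => pendant_injective hn o e).symm
    rw [this]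
    refine sum_subset ?_ ?_
    · intro A hA
      obtain ⟨i, hi, rfl⟩ := mem_image.1 hA
      simpa using (separates_pendant_iff (by omega) o i).2 hi
    · intro A hA hA'
      have hs : Separates A I := by simpa using hA
      by_cases ho : o ∈ A
      · have h1 : f A = 0 := by_contra fun e => hf.not_mem A e ho
        have h2 : g A = 0 := by_contra fun e => hg.not_mem A e ho
        rw [h1, h2, sub_zero]
      have hne : A ≠ ∅ := by rintro rfl; simp [Separates] at hs
      by_cases hb : 2 ≤ #A ∧ A ≠ X
      · rw [hbig A hb, sub_self]
      · obtain ⟨i, rfl⟩ := exists_eq_pendant hne ho hb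
        exact absurd (mem_image_of_mem _ ((separates_pendant_iff (by omega) o i).1 hs)) hA'
  funext A
  by_cases ho : o ∈ A
  · have h1 : f A = 0 := by_contra fun e => hf.not_mem A e ho
    have h2 : g A = 0 := by_contra fun e => hg.not_mem A e ho
    rw [h1, h2]
  by_cases hne : A = ∅
  · rw [hne, hf.empty, hg.empty]
  by_cases hb : 2 ≤ #A ∧ A ≠ X
  · exact hbig A hb
  · obtain ⟨i, rfl⟩ := exists_eq_pendant hne ho hb
    exact sub_eq_zero.1 (hpend i)

/-! ### Contraction of the bad splits -/

/-- The total weight of the sets that divide every `k`-set. -/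
noncomputable def badSum (k : ℕ) (f : Finset α → ℝ) : ℝ := ∑ A with ¬ Good k A, f A

/-- Contraction of the edges that divide every `k`-set, with their weights distributed over the
edges at the leaves. -/
noncomputable def contract (o : α) (k : ℕ) (f : Finset α → ℝ) (A : Finset α) : ℝ :=
  if A = ∅ then 0 else (if Good k A then f A else 0) +
    if A ∈ univ.image (pendant o) then badSum k f / k else 0

theorem contract_of_ne {o : α} {k : ℕ} (f : Finset α → ℝ) {A : Finset α} (hA : A ≠ ∅) :
    contract o k f A = (if Good k A then f A else 0) +
      if A ∈ univ.image (pendant o) then badSum k f / k else 0 := if_neg hA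

theorem contract_pendant {k : ℕ} (hkn : k + 1 ≤ Fintype.card α) (hn : 3 ≤ Fintype.card α) (o : α)
    (f : Finset α → ℝ) (i : α) :
    contract o k f (pendant o i) = f (pendant o i) + badSum k f / k := by
  rw [contract_of_ne f (pendant_ne_empty hn o i), if_pos (good_pendant hkn o i),
    if_pos (mem_image_of_mem _ (mem_univ i))]

/-- The lost weight `badSum k f` was counted in full for every `k`-set, and each `k`-set is
separated by exactly `k` pendant splits, each of which gained a `k`-th of it. -/
theorem sepSum_contract {k : ℕ} (hk : 2 ≤ k) (hkn : k + 1 ≤ Fintype.card α) (o : α)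
    (f : Finset α → ℝ) {I : Finset α} (hI : #I = k) :
    sepSum (contract o k f) I = sepSum f I := by
  have hn : 3 ≤ Fintype.card α := by omega
  have h1 : sepSum (contract o k f) I = ∑ A with Separates A I, (if Good k A then f A else 0) +
      ∑ A with Separates A I, if A ∈ univ.image (pendant o) then badSum k f / k else 0 := by
    rw [← sum_add_distrib]
    refine sum_congr rfl fun A hA => contract_of_ne f ?_
    rintro rfl
    obtain ⟨⟨i, -, hi⟩, -⟩ := (mem_filter.1 hA).2
    exact notMem_empty i hi
  have h2 : ∑ A with Separates A I, (if A ∈ univ.image (pendant o) then badSum k f / k else 0) =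
      badSum k f := by
    rw [← sum_filter, filter_filter]
    have : (univ.filter fun A => Separates A I ∧ A ∈ univ.image (pendant o)) =
        I.image (pendant o) := by
      ext A
      simp only [mem_filter, mem_univ, true_and, mem_image]
      constructor
      · rintro ⟨h, i, rfl⟩
        exact ⟨i, (separates_pendant_iff (by omega) o i).1 h, rfl⟩
      · rintro ⟨i, hi, rfl⟩
        exact ⟨(separates_pendant_iff (by omega) o i).2 hi, i, rfl⟩
    rw [this, sum_const, card_image_of_injective _ (pendant_injective hn o), hI, nsmul_eq_mul]
    have hk' : (k : ℝ) ≠ 0 := by positivity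
    field_simp
  have h3 : badSum k f = ∑ A with Separates A I, if Good k A then 0 else f A := by
    unfold badSum
    rw [sum_filter, sum_filter]
    refine sum_congr rfl fun A _ => ?_
    by_cases hA : Good k A
    · simp [hA]
    · simp [hA, separates_of_not_good hA hI]
  rw [h1, h2, h3, ← sum_add_distrib]
  refine sum_congr rfl fun A _ => ?_
  split_ifs <;> simp

theorem sum_contract {k : ℕ} (hk : 2 ≤ k) (hkn : k + 1 ≤ Fintype.card α) (o : α)
    {f : Finset α → ℝ} (hf : f ∅ = 0) :
    ∑ A, contract o k f A = ∑ A, f A + (Fintype.card α - k) * (badSum k f / k) := by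
  have hn : 3 ≤ Fintype.card α := by omega
  have h1 : ∑ A, contract o k f A = ∑ A, ((if Good k A then f A else 0) +
      if A ∈ univ.image (pendant o) then badSum k f / k else 0) := by
    refine sum_congr rfl fun A _ => ?_
    by_cases hA : A = ∅
    · subst hA
      have : (∅ : Finset α) ∉ univ.image (pendant o) := by
        simp [pendant_ne_empty hn o]
      rw [if_neg this, hf]
      simp [contract]
    · exact contract_of_ne f hA
  have h3 : ∑ A, f A = ∑ A, (if Good k A then f A else 0) + badSum k f := by
    unfold badSum
    rw [sum_filter, ← sum_add_distrib]
    refine sum_congr rfl fun A _ => ?_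
    split_ifs <;> simp
  rw [h1, sum_add_distrib, ← sum_filter, h3, sum_filter, sum_ite_mem, univ_inter, sum_const,
    card_image_of_injective _ (pendant_injective hn o), card_univ, nsmul_eq_mul]
  have hk' : (k : ℝ) ≠ 0 := by positivity
  field_simp
  ring

end SetWeight

/-! ### Recovering a tree from its split weights -/

namespace LeafLabelledTree

open SimpleGraph Finset
open scoped Classical

variable {n : ℕ} {T : LeafLabelledTree n} {o : Fin n}

variable (T o) in
/-- The vertices whose parent is `v`. -/
noncomputable def children (v : T.V) : Finset T.V :=
  univ.filter fun c => c ≠ T.leaf o ∧ T.par o c = v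

theorem mem_children {c v : T.V} : c ∈ T.children o v ↔ c ≠ T.leaf o ∧ T.par o c = v := by
  simp [children]

theorem deg_leaf (i : Fin n) : T.deg (T.leaf i) = 1 := T.leaf_degree i

theorem deg_of_ne_root {v : T.V} (hv : v ≠ T.leaf o) : T.deg v = #(T.children o v) + 1 := by
  have hnot : T.par o v ∉ T.children o v := by
    intro h
    obtain ⟨h1, h2⟩ := mem_children.1 h
    have := T.below_par o h1
    rw [h2] at this
    exact T.not_par_below o hv this
  have : T.G.neighborSet v = (insert (T.par o v) (T.children o v) : Finset T.V) := by
    ext x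
    simp only [mem_neighborSet, coe_insert, Set.mem_insert_iff, mem_coe, mem_children,
      adj_iff (o := o) (x := v), eq_comm (a := x)]
    simp [hv]
  rw [deg, this, Set.ncard_coe_finset, card_insert_of_notMem hnot]

theorem card_children_root : #(T.children o (T.leaf o)) = 1 := by
  have : T.G.neighborSet (T.leaf o) = (T.children o (T.leaf o) : Finset T.V) := by
    ext x
    simp only [mem_neighborSet, mem_coe, mem_children, adj_iff (o := o) (x := T.leaf o)]
    simp
  rw [← deg_leaf o, deg, this, Set.ncard_coe_finset]

theorem child_below {c v : T.V} (h : c ∈ T.children o v) : T.Below o c v := by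
  obtain ⟨h1, rfl⟩ := mem_children.1 h
  exact T.below_par o h1

theorem depth_child {c v : T.V} (h : c ∈ T.children o v) : T.depth o c = T.depth o v + 1 := by
  obtain ⟨h1, rfl⟩ := mem_children.1 h
  exact T.depth_par o h1

theorem Below.exists_mem_children {x v : T.V} (h : T.Below o x v) (hne : x ≠ v) :
    ∃ c ∈ T.children o v, T.Below o x c := by
  obtain ⟨c, h1, h2, h3⟩ := h.exists_child hne
  exact ⟨c, mem_children.2 ⟨h1, h2⟩, h3⟩

theorem eq_leaf_of_below {i : Fin n} (hi : i ≠ o) {x : T.V} (hx : T.Below o x (T.leaf i)) :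
    x = T.leaf i := by
  by_contra hne
  obtain ⟨c, hc, -⟩ := hx.exists_mem_children hne
  have := deg_of_ne_root (o := o) fun h => hi (T.leaf_injective h)
  rw [deg_leaf] at this
  have := card_pos.2 ⟨c, hc⟩
  omega

theorem cluster_leaf {i : Fin n} (hi : i ≠ o) : T.cluster o (T.leaf i) = {i} := by
  ext j
  rw [mem_cluster, mem_singleton]
  exact ⟨fun h => T.leaf_injective (eq_leaf_of_below hi h), fun h => h ▸ T.below_refl o _⟩

theorem cluster_child_root {c : T.V} (hc : c ∈ T.children o (T.leaf o)) :
    T.cluster o c = univ.erase o := by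
  ext j
  rw [mem_cluster, mem_erase]
  constructor
  · rintro h
    refine ⟨?_, mem_univ _⟩
    rintro rfl
    exact (mem_children.1 hc).1 ((T.root_below_iff j).1 h)
  · rintro ⟨hj, -⟩
    obtain ⟨c', hc', h⟩ := (T.below_root o (T.leaf j)).exists_mem_children
      fun h => hj (T.leaf_injective h)
    rwa [card_le_one.1 card_children_root.le c hc c' hc']

theorem exists_deepest {p : T.V → Prop} (h : ∃ v, p v) :
    ∃ v, p v ∧ ∀ u, p u → T.depth o u ≤ T.depth o v := by
  obtain ⟨v, hv⟩ := h
  obtain ⟨u, hu, hmax⟩ := exists_max_image (univ.filter p) (T.depth o) ⟨v, by simp [hv]⟩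
  simp only [mem_filter, mem_univ, true_and] at hu hmax
  exact ⟨u, hu, hmax⟩

/-- A deepest vertex below `v` has no child, so it is the root or has degree one and hence a label.
-/
theorem exists_leaf_below (hL : T.LeafSetEq) (v : T.V) : ∃ i, T.Below o (T.leaf i) v := by
  obtain ⟨u, hu, hmax⟩ := exists_deepest (o := o)
    (p := fun u => T.Below o u v) ⟨v, T.below_refl o v⟩
  by_cases hr : u = T.leaf o
  · exact ⟨o, hr ▸ hu⟩
  have hdeg : T.deg u = 1 := by
    rw [deg_of_ne_root hr]
    by_contra h
    obtain ⟨c, hc⟩ := card_pos.1 (by omega : 0 < #(T.children o u))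
    have := hmax c ((child_below hc).trans hu)
    rw [depth_child hc] at this
    omega
  obtain ⟨i, rfl⟩ := hL u hdeg
  exact ⟨i, hu⟩

theorem cluster_nonempty (hL : T.LeafSetEq) (v : T.V) : (T.cluster o v).Nonempty := by
  obtain ⟨i, hi⟩ := exists_leaf_below (o := o) hL v
  exact ⟨i, mem_cluster.2 hi⟩

theorem comparable_of_cluster_subset (hL : T.LeafSetEq) {u v : T.V}
    (h : T.cluster o u ⊆ T.cluster o v) : T.Below o u v ∨ T.Below o v u := by
  obtain ⟨i, hi⟩ := cluster_nonempty (o := o) hL u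
  exact (mem_cluster.1 hi).total (mem_cluster.1 (h hi))

theorem below_of_cluster_ssubset (hL : T.LeafSetEq) {u v : T.V}
    (h : T.cluster o u ⊂ T.cluster o v) : T.Below o u v :=
  (comparable_of_cluster_subset hL h.1).resolve_right fun h' => h.2 (cluster_mono h')

/-- Below a vertex of degree different from two the clusters are strictly smaller. -/
theorem cluster_ssubset (hL : T.LeafSetEq) {u v : T.V} (h : T.Below o u v) (hne : u ≠ v)
    (hv : T.deg v ≠ 2) : T.cluster o u ⊂ T.cluster o v := by
  refine (cluster_mono h).ssubset_of_ne fun e => ?_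
  have hr : v ≠ T.leaf o := by
    rintro rfl
    rw [cluster_root] at e
    have : o ∈ T.cluster o u := e ▸ mem_univ o
    exact hne ((T.root_below_iff o).1 (mem_cluster.1 this))
  obtain ⟨c, hc, huc⟩ := h.exists_mem_children hne
  have hd := deg_of_ne_root hr
  have : 1 < #(T.children o v) := by
    have := card_pos.2 ⟨c, hc⟩
    omega
  obtain ⟨c', hc', hcc⟩ := exists_mem_ne this c
  obtain ⟨i, hi⟩ := exists_leaf_below (o := o) hL c'
  have hiu : T.Below o (T.leaf i) u :=
    mem_cluster.1 (e ▸ mem_cluster.2 (hi.trans (child_below hc')))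
  exact hcc (children_eq (mem_children.1 hc').1 (mem_children.1 hc).1 (mem_children.1 hc').2
    (mem_children.1 hc).2 hi (hiu.trans huc))

/-- Vertices with the same cluster lie on a common root path, and along it the cluster grows
strictly on entering a vertex of degree other than two. So the vertices that survive suppression are
identified by their clusters. -/
theorem eq_of_cluster_eq (hL : T.LeafSetEq) {u v : T.V} (hu : T.deg u ≠ 2) (hv : T.deg v ≠ 2)
    (h : T.cluster o u = T.cluster o v) : u = v := by
  by_contra hne
  rcases comparable_of_cluster_subset hL h.subset with h' | h'
  · exact (cluster_ssubset hL h' hne hv).ne h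
  · exact (cluster_ssubset hL h' (Ne.symm hne) hu).ne h.symm

theorem ne_root_of_deg {v : T.V} (hv : T.deg v ≠ 1) : v ≠ T.leaf o := by
  rintro rfl
  exact hv (deg_leaf o)

theorem cluster_child {c v : T.V} (hv : T.deg v = 2) (hc : c ∈ T.children o v) :
    T.cluster o c = T.cluster o v := by
  refine (cluster_mono (child_below hc)).antisymm fun i hi => ?_
  have hr : v ≠ T.leaf o := ne_root_of_deg (by omega)
  have hcard : #(T.children o v) = 1 := by have := deg_of_ne_root hr; omega
  obtain ⟨c', hc', h⟩ := (mem_cluster.1 hi).exists_mem_children (v := v) (by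
    rintro rfl
    rw [deg_leaf] at hv
    omega)
  rw [card_le_one.1 hcard.le c hc c' hc']
  exact mem_cluster.2 h

theorem exists_deg_ne_two (v : T.V) :
    ∃ u, T.deg u ≠ 2 ∧ T.cluster o u = T.cluster o v := by
  obtain ⟨u, hu, hmax⟩ := exists_deepest (o := o)
    (p := fun u => T.cluster o u = T.cluster o v) ⟨v, rfl⟩
  refine ⟨u, fun hd => ?_, hu⟩
  have := deg_of_ne_root (o := o) (ne_root_of_deg (by omega : T.deg u ≠ 1))
  obtain ⟨c, hc⟩ := card_pos.1 (by omega : 0 < #(T.children o u))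
  have := hmax c ((cluster_child hd hc).trans hu)
  rw [depth_child hc] at this
  omega

theorem PositiveWeighted.parWeight_pos (hp : T.PositiveWeighted) {v : T.V} (hv : v ≠ T.leaf o) :
    0 < T.parWeight o v := hp _ (T.adj_par o hv)

theorem PositiveWeighted.splitWeight_nonneg (hp : T.PositiveWeighted) (A : Finset (Fin n)) :
    0 ≤ T.splitWeight o A :=
  sum_nonneg fun _ hv => (hp.parWeight_pos (mem_filter.1 hv).2.1).le

theorem exists_of_splitWeight_ne_zero {A : Finset (Fin n)} (h : T.splitWeight o A ≠ 0) :
    ∃ v, v ≠ T.leaf o ∧ T.cluster o v = A := by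
  obtain ⟨v, hv, -⟩ := exists_ne_zero_of_sum_ne_zero h
  exact ⟨v, (mem_filter.1 hv).2⟩

theorem PositiveWeighted.splitWeight_pos (hp : T.PositiveWeighted) {v : T.V}
    (hv : v ≠ T.leaf o) : 0 < T.splitWeight o (T.cluster o v) :=
  sum_pos (fun _ hu => hp.parWeight_pos (mem_filter.1 hu).2.1) ⟨v, by simp [hv]⟩

theorem exists_path_up {a b : T.V} (h : T.Below o a b) :
    ∃ p : T.G.Walk a b, p.IsPath ∧ (∀ x, x ∈ p.support ↔ T.Below o a x ∧ T.Below o x b) ∧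
      T.walkWeight p = ∑ v with T.Below o a v ∧ T.Below o v b ∧ v ≠ b, T.parWeight o v := by
  have hnil : ∃ p : T.G.Walk b b, p.IsPath ∧
      (∀ x, x ∈ p.support ↔ T.Below o b x ∧ T.Below o x b) ∧
      T.walkWeight p = ∑ v with T.Below o b v ∧ T.Below o v b ∧ v ≠ b, T.parWeight o v := by
    refine ⟨Walk.nil, Walk.IsPath.nil, fun x => ?_, ?_⟩
    · simp only [Walk.support_nil, List.mem_singleton]
      constructor
      · rintro rfl
        exact ⟨T.below_refl o _, T.below_refl o _⟩
      · rintro ⟨h1, h2⟩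
        exact h2.antisymm h1
    · rw [filter_eq_empty_iff.2 fun v _ h => h.2.2 (h.2.1.antisymm h.1)]
      simp [walkWeight]
  induction a using T.root_induction o with
  | root =>
    obtain rfl := (T.root_below_iff o).1 h
    exact hnil
  | step a ha ih =>
    by_cases hab : a = b
    · subst hab
      exact hnil
    have hpb := h.par_below hab
    obtain ⟨p, hp, hs, hw⟩ := ih hpb
    have hna : a ∉ p.support := fun h' => T.not_par_below o ha ((hs a).1 h').1
    refine ⟨Walk.cons (T.adj_par o ha) p, (Walk.cons_isPath_iff _ _).2 ⟨hp, hna⟩, fun x => ?_, ?_⟩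
    · rw [Walk.support_cons, List.mem_cons, hs, T.below_iff o ha]
      constructor
      · rintro (rfl | h')
        · exact ⟨Or.inl rfl, h⟩
        · exact ⟨Or.inr h'.1, h'.2⟩
      · rintro ⟨rfl | h1, h2⟩
        · exact Or.inl rfl
        · exact Or.inr ⟨h1, h2⟩
    · have hset : (univ.filter fun v => T.Below o a v ∧ T.Below o v b ∧ v ≠ b) =
          insert a (univ.filter fun v => T.Below o (T.par o a) v ∧ T.Below o v b ∧ v ≠ b) := by
        ext v
        simp only [mem_filter, mem_univ, true_and, mem_insert, T.below_iff o ha]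
        constructor
        · rintro ⟨rfl | h1, h2⟩
          · exact Or.inl rfl
          · exact Or.inr ⟨h1, h2⟩
        · rintro (rfl | ⟨h1, h2⟩)
          · exact ⟨Or.inl rfl, h, hab⟩
          · exact ⟨Or.inr h1, h2⟩
      rw [hset, sum_insert (by simp [T.not_par_below o ha]), ← hw]
      simp [walkWeight, parWeight]

theorem ReducedEdge.symm {a b : T.V} {r : ℝ} (h : T.ReducedEdge a b r) : T.ReducedEdge b a r := by
  obtain ⟨hne, p, hp, hs, hw⟩ := h
  refine ⟨hne.symm, p.reverse, hp.reverse, fun x hx => ?_, ?_⟩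
  · rw [Walk.support_reverse, List.mem_reverse] at hx
    rcases hs x hx with h | h | h <;> simp [h]
  · rw [← hw, walkWeight, walkWeight, Walk.edges_reverse, List.map_reverse, List.sum_reverse]

/-- Otherwise the path passes through the lowest common ancestor of `a` and `b`, which has two
children and a parent or is the root, so its degree is not two. -/
theorem ReducedEdge.comparable {a b : T.V} {r : ℝ} (h : T.ReducedEdge a b r) :
    T.Below o a b ∨ T.Below o b a := by
  by_contra! hno
  obtain ⟨-, p, -, hs, -⟩ := h
  obtain ⟨m, ⟨ham, hbm⟩, hmax⟩ := exists_deepest (o := o)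
    (p := fun x => T.Below o a x ∧ T.Below o b x) ⟨_, T.below_root o a, T.below_root o b⟩
  have hma : a ≠ m := by rintro rfl; exact hno.2 hbm
  have hmb : b ≠ m := by rintro rfl; exact hno.1 ham
  obtain ⟨c, hc, hac⟩ := ham.exists_mem_children hma
  obtain ⟨c', hc', hbc⟩ := hbm.exists_mem_children hmb
  have hnbc : ¬ T.Below o b c := fun h' => by
    have := hmax c ⟨hac, h'⟩
    rw [depth_child hc] at this
    omega
  have hcc : c ≠ c' := by rintro rfl; exact hnbc hbc
  have htwo : 1 < #(T.children o m) := one_lt_card.2 ⟨c, hc, c', hc', hcc⟩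
  obtain ⟨d, hd, h1, h2⟩ := p.exists_boundary_dart {z | T.Below o z c} hac hnbc
  have hd2 : d.snd = m := by
    rw [(eq_of_adj_of_below d.adj h1 h2).2, (mem_children.1 hc).2]
  have hm : m ∈ p.support := hd2 ▸ p.dart_snd_mem_support_of_mem_darts hd
  rcases hs m hm with h | h | h
  · exact hma h.symm
  · exact hmb h.symm
  · have := deg_of_ne_root (o := o) (ne_root_of_deg (by omega : T.deg m ≠ 1))
    omega

/-- `B` is the smallest set above `A`, among those where `f` does not vanish, and `f A = r`. -/
def _root_.SetWeight.CoversWith {α : Type*} (f : Finset α → ℝ) (A B : Finset α) (r : ℝ) : Prop :=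
  A ⊂ B ∧ (∀ C, f C ≠ 0 → A ⊂ C → ¬ C ⊂ B) ∧ f A = r

/-- A vertex of degree two has the cluster of its only child; the equality is carried down to `a` by
induction on the distance. -/
theorem interior_cluster_eq {a b v : T.V}
    (h : ∀ x, T.Below o a x → T.Below o x b → x = a ∨ x = b ∨ T.deg x = 2)
    (hav : T.Below o a v) (hvb : T.Below o v b) (hne : v ≠ b) :
    T.cluster o v = T.cluster o a := by
  induction hd : T.depth o a - T.depth o v generalizing v with
  | zero =>
    rcases hav.eq_or_depth_lt with rfl | h'
    · rfl
    · omega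
  | succ d ih =>
    have hva : v ≠ a := by rintro rfl; omega
    have h2 : T.deg v = 2 := ((h v hav hvb).resolve_left hva).resolve_left hne
    obtain ⟨c, hc, hac⟩ := hav.exists_mem_children hva.symm
    rw [← cluster_child h2 hc]
    have hcb := (child_below hc).trans hvb
    refine ih hac hcb ?_ ?_
    · rintro rfl
      exact hne (hvb.antisymm (child_below hc))
    · rw [depth_child hc]; omega

/-- A chain of degree-two vertices from `a` up to `b` consists of the vertices with the cluster of
`a`, so its weight is a split weight. An interior vertex of another degree would put a cluster
strictly between those of `a` and `b`. -/
theorem reducedEdge_up_iff (hL : T.LeafSetEq) (hp : T.PositiveWeighted) {a b : T.V} {r : ℝ}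
    (ha : T.deg a ≠ 2) (hb : T.deg b ≠ 2) (hab : T.Below o a b) :
    T.ReducedEdge a b r ↔
      SetWeight.CoversWith (T.splitWeight o) (T.cluster o a) (T.cluster o b) r := by
  obtain ⟨p, hpp, hps, hpw⟩ := exists_path_up hab
  have hsum : a ≠ b →
      (∀ x, T.Below o a x → T.Below o x b → x = a ∨ x = b ∨ T.deg x = 2) →
      T.walkWeight p = T.splitWeight o (T.cluster o a) := by
    intro hne h
    rw [hpw, splitWeight]
    refine sum_congr ?_ fun _ _ => rfl
    ext v
    simp only [mem_filter, mem_univ, true_and]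
    constructor
    · rintro ⟨h1, h2, h3⟩
      refine ⟨?_, interior_cluster_eq h h1 h2 h3⟩
      rintro rfl
      exact h3 ((T.root_below_iff o).1 h2).symm
    · rintro ⟨-, h1⟩
      have hav : T.Below o a v := by
        rcases comparable_of_cluster_subset hL h1.symm.subset with h' | h'
        · exact h'
        · by_cases e : v = a
          · exact e ▸ T.below_refl o _
          · exact absurd h1 (cluster_ssubset hL h' e ha).ne
      have hlt := cluster_ssubset hL hab hne hb
      rw [← h1] at hlt
      exact ⟨hav, below_of_cluster_ssubset hL hlt, fun e => hlt.ne (e ▸ rfl)⟩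
  constructor
  · rintro ⟨hne, q, hq, hqs, hqw⟩
    obtain rfl : q = p := by
      have := (T.isTree.isAcyclic.subsingleton_path a b).elim ⟨q, hq⟩ ⟨p, hpp⟩
      exact congrArg Subtype.val this
    have hint : ∀ x, T.Below o a x → T.Below o x b → x = a ∨ x = b ∨ T.deg x = 2 :=
      fun x h1 h2 => hqs x ((hps x).2 ⟨h1, h2⟩)
    refine ⟨cluster_ssubset hL hab hne hb, fun C hC h1 h2 => ?_, ?_⟩
    · obtain ⟨v, -, rfl⟩ := exists_of_splitWeight_ne_zero hC
      exact h1.ne (interior_cluster_eq hint (below_of_cluster_ssubset hL h1)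
        (below_of_cluster_ssubset hL h2) fun e => h2.ne (e ▸ rfl)).symm
    · rw [← hqw, hsum hne hint]
  · rintro ⟨h1, h2, h3⟩
    have hne : a ≠ b := by rintro rfl; exact h1.ne rfl
    have hint : ∀ x, T.Below o a x → T.Below o x b → x = a ∨ x = b ∨ T.deg x = 2 := by
      intro x hax hxb
      by_contra! hx
      obtain ⟨hxa, hxb', hx2⟩ := hx
      have hxr : x ≠ T.leaf o := by
        rintro rfl
        exact hxb' ((T.root_below_iff o).1 hxb).symm
      exact h2 _ (hp.splitWeight_pos hxr).ne' (cluster_ssubset hL hax hxa.symm hx2)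
        (cluster_ssubset hL hxb hxb' hb)
    refine ⟨hne, p, hpp, fun x hx => hint x ((hps x).1 hx).1 ((hps x).1 hx).2, ?_⟩
    rw [hsum hne hint, h3]

theorem reducedEdge_iff (hL : T.LeafSetEq) (hp : T.PositiveWeighted) {a b : T.V} {r : ℝ}
    (ha : T.deg a ≠ 2) (hb : T.deg b ≠ 2) : T.ReducedEdge a b r ↔
      SetWeight.CoversWith (T.splitWeight o) (T.cluster o a) (T.cluster o b) r ∨
      SetWeight.CoversWith (T.splitWeight o) (T.cluster o b) (T.cluster o a) r := by
  constructor
  · intro h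
    rcases h.comparable (o := o) with h' | h'
    · exact Or.inl ((reducedEdge_up_iff hL hp ha hb h').1 h)
    · exact Or.inr ((reducedEdge_up_iff hL hp hb ha h').1 h.symm)
  · rintro (h | h)
    · exact (reducedEdge_up_iff hL hp ha hb (below_of_cluster_ssubset hL h.1)).2 h
    · exact ((reducedEdge_up_iff hL hp hb ha (below_of_cluster_ssubset hL h.1)).2 h).symm

theorem exists_cluster_eq {T' : LeafLabelledTree n} (hp : T.PositiveWeighted)
    (h : T.splitWeight o = T'.splitWeight o) (v : T.V) :
    ∃ u : T'.V, T'.deg u ≠ 2 ∧ T'.cluster o u = T.cluster o v := by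
  by_cases hv : v = T.leaf o
  · exact ⟨T'.leaf o, by rw [deg_leaf]; omega, by rw [hv, cluster_root, cluster_root]⟩
  · have := (hp.splitWeight_pos hv).ne'
    rw [h] at this
    obtain ⟨w, -, hw⟩ := exists_of_splitWeight_ne_zero this
    obtain ⟨u, hu, hu'⟩ := exists_deg_ne_two (o := o) w
    exact ⟨u, hu, hu'.trans hw⟩

/-- Trees with the same weights of their splits are equivalent. -/
theorem equivalent_of_splitWeight_eq {T' : LeafLabelledTree n} (hL : T.LeafSetEq)
    (hL' : T'.LeafSetEq) (hp : T.PositiveWeighted) (hp' : T'.PositiveWeighted)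
    (h : T.splitWeight o = T'.splitWeight o) : T.Equivalent T' := by
  choose φ hφ hφc using fun v : {v : T.V // T.deg v ≠ 2} => exists_cluster_eq hp h v.1
  choose ψ hψ hψc using fun v : {v : T'.V // T'.deg v ≠ 2} => exists_cluster_eq hp' h.symm v.1
  refine ⟨⟨fun v => ⟨φ v, hφ v⟩, fun v => ⟨ψ v, hψ v⟩, fun v => ?_, fun v => ?_⟩, ?_, ?_⟩
  · exact Subtype.ext (eq_of_cluster_eq (o := o) hL (hψ _) v.2 ((hψc _).trans (hφc _)))
  · exact Subtype.ext (eq_of_cluster_eq (o := o) hL' (hφ _) v.2 ((hφc _).trans (hψc _)))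
  · intro i a ha
    refine eq_of_cluster_eq (o := o) hL' (hφ a) (by rw [deg_leaf]; omega) ((hφc a).trans ?_)
    rw [ha]
    by_cases hi : i = o
    · rw [hi, cluster_root, cluster_root]
    · rw [cluster_leaf hi, cluster_leaf hi]
  · intro a b r
    simp only [Equiv.coe_fn_mk]
    rw [reducedEdge_iff (o := o) hL hp a.2 b.2, reducedEdge_iff (o := o) hL' hp' (hφ a) (hφ b),
      hφc, hφc, h]

theorem Essential.reducedEdge_iff (hE : T.Essential) {a b : T.V} {r : ℝ} :
    T.ReducedEdge a b r ↔ T.G.Adj a b ∧ T.w s(a, b) = r := by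
  constructor
  · rintro ⟨hne, p, hp, hs, hw⟩
    cases p with
    | nil => exact absurd rfl hne
    | @cons _ c _ h q =>
      rw [Walk.cons_isPath_iff] at hp
      rcases hs c (by simp) with rfl | rfl | h2
      · exact absurd rfl h.ne
      · obtain rfl : q = Walk.nil := (Walk.isPath_iff_nil.1 hp.1).eq_nil
        exact ⟨h, by simpa [walkWeight] using hw⟩
      · exact absurd h2 (hE c)
  · rintro ⟨h, hw⟩
    refine ⟨h.ne, h.toWalk, Walk.IsPath.of_adj h, fun x hx => ?_, by simpa [walkWeight] using hw⟩
    have : x = a ∨ x = b := by simpa using hx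
    tauto

theorem Equivalent.isomorphic {T' : LeafLabelledTree n} (h : T.Equivalent T') (hE : T.Essential)
    (hE' : T'.Essential) : T.Isomorphic T' := by
  obtain ⟨φ, hφ, hr⟩ := h
  let e : T.V ≃ T'.V := (Equiv.subtypeUnivEquiv hE).symm.trans (φ.trans (Equiv.subtypeUnivEquiv hE'))
  have key : ∀ a b r, (T.G.Adj a b ∧ T.w s(a, b) = r) ↔
      (T'.G.Adj (e a) (e b) ∧ T'.w s(e a, e b) = r) := by
    intro a b r
    rw [← hE.reducedEdge_iff, ← hE'.reducedEdge_iff]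
    exact hr ⟨a, hE a⟩ ⟨b, hE b⟩ r
  refine ⟨⟨e, fun {a b} => ?_⟩, fun i => hφ i ⟨T.leaf i, hE _⟩ rfl, fun a b hab => ?_⟩
  · exact ⟨fun h => ((key a b _).2 ⟨h, rfl⟩).1, fun h => ((key a b _).1 ⟨h, rfl⟩).1⟩
  · exact ((key a b _).1 ⟨hab, rfl⟩).2

end LeafLabelledTree

/-! ### The tree of a laminar weight -/

namespace SetWeight

open Finset
open scoped Classical

variable {n : ℕ}

/-- The vertices of the tree of a laminar weight: the sets in its support and the set of all
labels. -/
abbrev ClusterVertex (f : Finset (Fin n) → ℝ) : Type :=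
  {A : Finset (Fin n) // f A ≠ 0 ∨ A = univ}

theorem pendant_self {α : Type*} [Fintype α] [DecidableEq α] (o : α) :
    pendant o o = univ.erase o := by
  ext; simp [pendant]

theorem pendant_of_ne {α : Type*} [Fintype α] {o i : α} (h : i ≠ o) : pendant o i = {i} := by
  simp [pendant, h]

theorem good_iff {α : Type*} [Fintype α] [DecidableEq α] {k : ℕ} {A : Finset α} :
    Good k A ↔ k ≤ #A ∨ k ≤ #Aᶜ := by
  unfold Good
  convert Iff.rfl

variable {o : Fin n} {f : Finset (Fin n) → ℝ}

/-- The set of all labels, as a vertex. -/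
def topVertex (f : Finset (Fin n) → ℝ) : ClusterVertex f := ⟨univ, Or.inr rfl⟩

theorem le_topVertex (A : ClusterVertex f) : A ≤ topVertex f := subset_univ A.1

theorem IsClusterWeight.vertex_nonempty (hf : IsClusterWeight o f) (A : ClusterVertex f) :
    A.1.Nonempty := by
  rcases A.2 with h | h
  · exact nonempty_iff_ne_empty.2 fun e => h (e ▸ hf.empty)
  · exact ⟨o, by rw [h]; exact mem_univ o⟩

theorem IsClusterWeight.mem_vertex_iff (hf : IsClusterWeight o f) (A : ClusterVertex f) :
    o ∈ A.1 ↔ A = topVertex f := by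
  constructor
  · intro h
    exact Subtype.ext (A.2.resolve_left fun h' => hf.not_mem _ h' h)
  · rintro rfl
    exact mem_univ o

theorem IsClusterWeight.vertex_total (hf : IsClusterWeight o f) {A B C : ClusterVertex f}
    (hB : A ≤ B) (hC : A ≤ C) : B ≤ C ∨ C ≤ B := by
  rcases B.2 with hB' | hB'
  · rcases C.2 with hC' | hC'
    · obtain ⟨i, hi⟩ := hf.vertex_nonempty A
      rcases hf.laminar B.1 C.1 hB' hC' with h | h | h
      · exact absurd (hC hi) (disjoint_left.1 h (hB hi))
      · exact Or.inl h
      · exact Or.inr h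
    · left
      change B.1 ⊆ C.1
      rw [hC']; exact subset_univ _
  · right
    change C.1 ⊆ B.1
    rw [hB']; exact subset_univ _

theorem exists_covBy_vertex {A : ClusterVertex f} (hA : A ≠ topVertex f) : ∃ B, A ⋖ B := by
  obtain ⟨B, hB, -⟩ := exists_covBy_le_of_lt ((le_topVertex A).lt_of_ne hA)
  exact ⟨B, hB⟩

/-- The smallest vertex above a vertex. -/
noncomputable def upper (A : ClusterVertex f) : ClusterVertex f :=
  if h : A ≠ topVertex f then (exists_covBy_vertex h).choose else A

theorem covBy_upper {A : ClusterVertex f} (hA : A ≠ topVertex f) : A ⋖ upper A := by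
  unfold upper
  rw [dif_pos hA]
  exact (exists_covBy_vertex hA).choose_spec

/-- Two vertices above `A` share an element of the nonempty set `A`, so laminarity makes them
comparable and the cover of `A` is unique. -/
theorem IsClusterWeight.upper_le (hf : IsClusterWeight o f) {A B : ClusterVertex f}
    (h : A < B) : upper A ≤ B := by
  have hA : A ≠ topVertex f := fun e => (h.trans_le (le_topVertex B)).ne e
  rcases hf.vertex_total h.le (covBy_upper hA).le with h' | h'
  · rcases h'.eq_or_lt with e | h'
    · exact e.ge
    · exact absurd h' ((covBy_upper hA).2 h)
  · exact h'

theorem IsClusterWeight.covBy_iff (hf : IsClusterWeight o f) {A B : ClusterVertex f} :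
    A ⋖ B ↔ A ≠ topVertex f ∧ upper A = B := by
  constructor
  · intro h
    have hA : A ≠ topVertex f := fun e => (h.lt.trans_le (le_topVertex B)).ne e
    refine ⟨hA, (hf.upper_le h.lt).eq_of_not_lt fun h' => h.2 (covBy_upper hA).lt h'⟩
  · rintro ⟨hA, rfl⟩
    exact covBy_upper hA

theorem vertex_induction {motive : ClusterVertex f → Prop} (top : motive (topVertex f))
    (step : ∀ A, A ≠ topVertex f → motive (upper A) → motive A) (A : ClusterVertex f) :
    motive A := by
  induction A using WellFoundedGT.induction with
  | _ A ih =>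
    by_cases hA : A = topVertex f
    · exact hA ▸ top
    · exact step A hA (ih _ (covBy_upper hA).lt)

/-- Climbing to the full set shows connectedness. Each edge joins a vertex other than the full set
to its unique cover, so there are fewer edges than vertices. -/
theorem IsClusterWeight.hasse_isTree (hf : IsClusterWeight o f) :
    (SimpleGraph.hasse (ClusterVertex f)).IsTree := by
  have hconn : (SimpleGraph.hasse (ClusterVertex f)).Connected := by
    have : Nonempty (ClusterVertex f) := ⟨topVertex f⟩
    have h : ∀ A, (SimpleGraph.hasse (ClusterVertex f)).Reachable A (topVertex f) := by
      intro A
      induction A using vertex_induction with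
      | top => rfl
      | step A hA ih => exact (SimpleGraph.Adj.reachable (Or.inl (covBy_upper hA))).trans ih
    exact ⟨fun A B => (h A).trans (h B).symm⟩
  rw [SimpleGraph.isTree_iff_connected_and_card]
  refine ⟨hconn, le_antisymm ?_ hconn.card_vert_le_card_edgeSet_add_one⟩
  let φ : {A : ClusterVertex f // A ≠ topVertex f} →
      (SimpleGraph.hasse (ClusterVertex f)).edgeSet :=
    fun A => ⟨s(A.1, upper A.1), Or.inl (covBy_upper A.2)⟩
  have hφ : Function.Surjective φ := by
    rintro ⟨e, he⟩
    induction e using Sym2.ind with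
    | _ A B =>
      rcases he with h | h
      · obtain ⟨hA, hB⟩ := (hf.covBy_iff (A := A) (B := B)).1 h
        subst hB
        exact ⟨⟨A, hA⟩, rfl⟩
      · obtain ⟨hB, hA⟩ := (hf.covBy_iff (A := B) (B := A)).1 h
        subst hA
        exact ⟨⟨B, hB⟩, Subtype.ext Sym2.eq_swap⟩
  have h1 := Nat.card_le_card_of_surjective φ hφ
  have h2 : Nat.card {A : ClusterVertex f // A ≠ topVertex f} < Nat.card (ClusterVertex f) := by
    simp only [Nat.card_eq_fintype_card]
    exact Fintype.card_subtype_lt (x := topVertex f) (by simp)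
  omega

/-- The vertex that carries a label. -/
noncomputable def leafVertex (hp : ∀ i, 0 < f (pendant o i)) (i : Fin n) : ClusterVertex f :=
  if h : i = o then topVertex f else ⟨{i}, Or.inl (by simpa [pendant, h] using (hp i).ne')⟩

theorem leafVertex_self (hp : ∀ i, 0 < f (pendant o i)) : leafVertex hp o = topVertex f := by
  simp [leafVertex]

theorem leafVertex_of_ne (hp : ∀ i, 0 < f (pendant o i)) {i : Fin n} (h : i ≠ o) :
    (leafVertex hp i).1 = {i} := by
  simp [leafVertex, h]

theorem IsClusterWeight.leafVertex_le_iff (hf : IsClusterWeight o f)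
    (hp : ∀ i, 0 < f (pendant o i)) {i : Fin n} {A : ClusterVertex f} :
    leafVertex hp i ≤ A ↔ i ∈ A.1 := by
  by_cases h : i = o
  · subst h
    rw [leafVertex_self, hf.mem_vertex_iff]
    exact ⟨fun h => (le_topVertex A).antisymm h, fun h => h.ge⟩
  · change (leafVertex hp i).1 ⊆ A.1 ↔ _
    rw [leafVertex_of_ne hp h, singleton_subset_iff]

theorem IsClusterWeight.leafVertex_injective (hf : IsClusterWeight o f)
    (hp : ∀ i, 0 < f (pendant o i)) : Function.Injective (leafVertex hp) := by
  intro i j h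
  have h1 := (hf.leafVertex_le_iff hp).1 h.le
  have h2 := (hf.leafVertex_le_iff hp).1 h.ge
  by_cases hj : j = o
  · by_cases hi : i = o
    · rw [hi, hj]
    · rw [leafVertex_of_ne hp hi] at h2
      exact (mem_singleton.1 h2).symm
  · rw [leafVertex_of_ne hp hj] at h1
    exact mem_singleton.1 h1

theorem IsClusterWeight.ncard_neighborSet_leafVertex (hf : IsClusterWeight o f)
    (hp : ∀ i, 0 < f (pendant o i)) (i : Fin n) :
    ((SimpleGraph.hasse (ClusterVertex f)).neighborSet (leafVertex hp i)).ncard = 1 := by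
  rw [Set.ncard_eq_one]
  by_cases hi : i = o
  · subst hi
    have hX : f (univ.erase i) ≠ 0 := pendant_self i ▸ (hp i).ne'
    have hXlt : (⟨univ.erase i, Or.inl hX⟩ : ClusterVertex f) < topVertex f :=
      (le_topVertex _).lt_of_ne fun e => by
        have := (hf.mem_vertex_iff _).2 e
        simp at this
    have hle : ∀ B : ClusterVertex f, B < topVertex f →
        B ≤ (⟨univ.erase i, Or.inl hX⟩ : ClusterVertex f) := by
      intro B hB x hx
      rw [mem_erase]
      refine ⟨?_, mem_univ x⟩
      rintro rfl
      exact hB.ne ((hf.mem_vertex_iff B).1 hx)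
    refine ⟨⟨univ.erase i, Or.inl hX⟩, ?_⟩
    ext B
    rw [leafVertex_self, SimpleGraph.mem_neighborSet, Set.mem_singleton_iff]
    constructor
    · rintro (h | h)
      · exact absurd h.lt (le_topVertex B).not_gt
      · exact (hle B h.lt).eq_of_not_lt fun h' => h.2 h' hXlt
    · rintro rfl
      exact Or.inr ⟨hXlt, fun C h1 h2 => h1.not_ge (hle C h2)⟩
  · have hA : leafVertex hp i ≠ topVertex f := by
      rw [← leafVertex_self hp]
      exact fun h => hi (hf.leafVertex_injective hp h)
    refine ⟨upper (leafVertex hp i), ?_⟩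
    ext B
    rw [SimpleGraph.mem_neighborSet, Set.mem_singleton_iff]
    constructor
    · rintro (h | h)
      · exact (hf.covBy_iff.1 h).2.symm
      · have hlt : B.1 ⊂ (leafVertex hp i).1 := h.lt
        rw [leafVertex_of_ne hp hi, ssubset_singleton_iff] at hlt
        exact absurd hlt (hf.vertex_nonempty B).ne_empty
    · rintro rfl
      exact Or.inl (covBy_upper hA)

/-- The tree of a laminar weight. -/
noncomputable def clusterTree (hf : IsClusterWeight o f) (hp : ∀ i, 0 < f (pendant o i)) :
    LeafLabelledTree n where
  V := ClusterVertex f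
  G := SimpleGraph.hasse (ClusterVertex f)
  isTree := hf.hasse_isTree
  -- For an edge `A ⋖ B` the intersection is the lower end `A`; this is a symmetric way to write `f
  -- A`.
  w := Sym2.lift ⟨fun A B => f (A.1 ∩ B.1), fun _ _ => congrArg f (inter_comm _ _)⟩
  leaf := leafVertex hp
  leaf_injective := hf.leafVertex_injective hp
  leaf_degree := hf.ncard_neighborSet_leafVertex hp

section

variable (hf : IsClusterWeight o f) (hp : ∀ i, 0 < f (pendant o i))

/-- A set of the support, as a vertex of the tree. -/
def toVertex : ClusterVertex f ≃ (clusterTree hf hp).V := Equiv.refl _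

theorem clusterTree_leaf (i : Fin n) :
    (clusterTree hf hp).leaf i = toVertex hf hp (leafVertex hp i) := rfl

theorem clusterTree_root : (clusterTree hf hp).leaf o = toVertex hf hp (topVertex f) := by
  rw [clusterTree_leaf, leafVertex_self]

theorem clusterTree_adj {A B : ClusterVertex f} :
    (clusterTree hf hp).G.Adj (toVertex hf hp A) (toVertex hf hp B) ↔ A ⋖ B ∨ B ⋖ A := Iff.rfl

theorem clusterTree_w (A B : ClusterVertex f) :
    (clusterTree hf hp).w s(toVertex hf hp A, toVertex hf hp B) = f (A.1 ∩ B.1) := rfl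

theorem clusterTree_ne_root {A : ClusterVertex f} :
    toVertex hf hp A ≠ (clusterTree hf hp).leaf o ↔ A ≠ topVertex f := by
  rw [clusterTree_root, (toVertex hf hp).injective.ne_iff]

theorem clusterTree_below_iff (A B : ClusterVertex f) :
    (clusterTree hf hp).Below o (toVertex hf hp A) (toVertex hf hp B) ↔ A ≤ B := by
  induction A using vertex_induction generalizing B with
  | top =>
    rw [← clusterTree_root hf hp, LeafLabelledTree.root_below_iff, clusterTree_root,
      (toVertex hf hp).injective.eq_iff]
    exact ⟨fun h => h.ge, fun h => (le_topVertex B).antisymm h⟩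
  | step A hA ih =>
    have hcov := covBy_upper hA
    have hadj := (clusterTree_adj hf hp).2 (Or.inl hcov)
    have hnot : toVertex hf hp A ∉
        ((clusterTree hf hp).rootPath o (toVertex hf hp (upper A))).support :=
      fun h => hcov.lt.not_ge ((ih A).1 h)
    have := (clusterTree hf hp).eq_rootPath o (SimpleGraph.Walk.cons hadj _)
      ((SimpleGraph.Walk.cons_isPath_iff _ _).2 ⟨(clusterTree hf hp).rootPath_isPath o _, hnot⟩)
    rw [LeafLabelledTree.Below, ← this, SimpleGraph.Walk.support_cons, List.mem_cons,
      (toVertex hf hp).injective.eq_iff]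
    constructor
    · rintro (rfl | h)
      · exact le_rfl
      · exact hcov.le.trans ((ih B).1 h)
    · intro h
      rcases h.eq_or_lt with e | h
      · exact Or.inl e.symm
      · exact Or.inr ((ih B).2 (hf.upper_le h))

theorem clusterTree_par {A : ClusterVertex f} (hA : A ≠ topVertex f) :
    (clusterTree hf hp).par o (toVertex hf hp A) = toVertex hf hp (upper A) := by
  have hcov := covBy_upper hA
  rcases (LeafLabelledTree.adj_iff (o := o)).1 ((clusterTree_adj hf hp).2 (Or.inl hcov)) with
    ⟨-, h⟩ | ⟨h1, h⟩
  · exact h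
  · have := (clusterTree hf hp).below_par o h1
    rw [h, clusterTree_below_iff] at this
    exact absurd this hcov.lt.not_ge

theorem clusterTree_cluster (A : ClusterVertex f) :
    (clusterTree hf hp).cluster o (toVertex hf hp A) = A.1 := by
  ext i
  rw [LeafLabelledTree.mem_cluster, clusterTree_leaf, clusterTree_below_iff,
    hf.leafVertex_le_iff hp]

theorem clusterTree_parWeight {A : ClusterVertex f} (hA : A ≠ topVertex f) :
    (clusterTree hf hp).parWeight o (toVertex hf hp A) = f A.1 := by
  rw [LeafLabelledTree.parWeight, clusterTree_par hf hp hA, clusterTree_w]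
  exact congrArg f (inter_eq_left.2 (covBy_upper hA).le)

theorem clusterTree_splitWeight : (clusterTree hf hp).splitWeight o = f := by
  funext A
  rw [LeafLabelledTree.splitWeight]
  by_cases hA : f A = 0
  · rw [hA]
    refine sum_eq_zero fun v hv => ?_
    obtain ⟨B, rfl⟩ := (toVertex hf hp).surjective v
    obtain ⟨h1, h2⟩ := (mem_filter.1 hv).2
    rw [clusterTree_cluster] at h2
    rw [clusterTree_parWeight hf hp ((clusterTree_ne_root hf hp).1 h1), h2, hA]
  · have hne : (⟨A, Or.inl hA⟩ : ClusterVertex f) ≠ topVertex f := fun e =>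
      hf.not_mem A hA ((hf.mem_vertex_iff _).2 e)
    rw [← clusterTree_parWeight hf hp hne]
    refine sum_eq_single _ (fun v hv hv' => ?_) fun h => ?_
    · obtain ⟨B, rfl⟩ := (toVertex hf hp).surjective v
      have h2 := (mem_filter.1 hv).2.2
      rw [clusterTree_cluster] at h2
      exact absurd (congrArg (toVertex hf hp) (Subtype.ext h2)) hv'
    · refine absurd (mem_filter.2 ⟨mem_univ _, (clusterTree_ne_root hf hp).2 hne, ?_⟩) h
      rw [clusterTree_cluster]

theorem clusterTree_positiveWeighted : (clusterTree hf hp).PositiveWeighted := by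
  have key : ∀ v, v ≠ (clusterTree hf hp).leaf o → 0 < (clusterTree hf hp).parWeight o v := by
    intro v hv
    obtain ⟨A, rfl⟩ := (toVertex hf hp).surjective v
    rw [clusterTree_ne_root] at hv
    rw [clusterTree_parWeight hf hp hv]
    exact (hf.nonneg A.1).lt_of_ne' (A.2.resolve_right fun h => hv (Subtype.ext h))
  intro e
  induction e using Sym2.ind with
  | _ x y =>
    intro h
    have h' : (clusterTree hf hp).G.Adj x y := h
    rcases (LeafLabelledTree.adj_iff (o := o)).1 h' with ⟨h1, rfl⟩ | ⟨h1, rfl⟩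
    · exact key x h1
    · rw [Sym2.eq_swap]
      exact key y h1

/-- An unlabelled vertex `A` is covered by its children, since each label in it lies below one of
them. No single child contains all of `A`, so there are two children besides the parent. -/
theorem clusterTree_deg {v : (clusterTree hf hp).V} (hv : ∀ i, (clusterTree hf hp).leaf i ≠ v) :
    2 < (clusterTree hf hp).deg v := by
  obtain ⟨A, rfl⟩ := (toVertex hf hp).surjective v
  rw [LeafLabelledTree.deg_of_ne_root (hv o).symm]
  have hbelow : ∀ i ∈ A.1, ∃ c ∈ (clusterTree hf hp).children o (toVertex hf hp A),
      (clusterTree hf hp).Below o ((clusterTree hf hp).leaf i) c := by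
    intro i hi
    refine LeafLabelledTree.Below.exists_mem_children ?_ (hv i)
    rwa [← LeafLabelledTree.mem_cluster, clusterTree_cluster]
  obtain ⟨i, hi⟩ := hf.vertex_nonempty A
  obtain ⟨c, hc, hic⟩ := hbelow i hi
  have hlt : ∃ j ∈ A.1, ¬ (clusterTree hf hp).Below o ((clusterTree hf hp).leaf j) c := by
    by_contra! h
    obtain ⟨C, rfl⟩ := (toVertex hf hp).surjective c
    have hAC : A ≤ C := by
      intro j hj
      have := h j hj
      rwa [← LeafLabelledTree.mem_cluster, clusterTree_cluster] at this
    have h1 := (clusterTree_below_iff hf hp A C).2 hAC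
    obtain ⟨h2, h3⟩ := LeafLabelledTree.mem_children.1 hc
    rw [← h3] at h1
    exact LeafLabelledTree.not_par_below _ o h2 h1
  obtain ⟨j, hj, hjc⟩ := hlt
  obtain ⟨c', hc', hjc'⟩ := hbelow j hj
  have : 1 < #((clusterTree hf hp).children o (toVertex hf hp A)) :=
    one_lt_card.2 ⟨c, hc, c', hc', by rintro rfl; exact hjc hjc'⟩
  omega

theorem clusterTree_leafSetEq : (clusterTree hf hp).LeafSetEq := by
  intro v hv
  by_contra! h
  have := clusterTree_deg hf hp h
  omega

theorem clusterTree_essential : (clusterTree hf hp).Essential := by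
  intro v hv
  by_cases h : ∃ i, (clusterTree hf hp).leaf i = v
  · obtain ⟨i, rfl⟩ := h
    rw [LeafLabelledTree.deg_leaf] at hv
    omega
  · have := clusterTree_deg hf hp (not_exists.1 h)
    omega

end

end SetWeight

/-! ### Pseudostars in terms of clusters -/

namespace LeafLabelledTree

open SetWeight Finset

variable {n : ℕ} {T : LeafLabelledTree n} {o : Fin n}

theorem isPseudostar_iff {k : ℕ} :
    T.IsPseudostar k ↔ T.LeafSetEq ∧ ∀ v, v ≠ T.leaf o → Good k (T.cluster o v) := by
  refine and_congr_right fun _ => ⟨fun h v hv => ?_, fun h u v huv => ?_⟩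
  · have := h _ _ (T.adj_par o hv)
    rwa [side_par hv, side_par_swap hv, Set.ncard_coe_finset, Set.ncard_coe_finset, ← good_iff]
      at this
  · rcases (adj_iff (o := o)).1 huv with ⟨h1, rfl⟩ | ⟨h1, rfl⟩
    · rw [side_par h1, side_par_swap h1, Set.ncard_coe_finset, Set.ncard_coe_finset, ← good_iff]
      exact h u h1
    · rw [side_par h1, side_par_swap h1, Set.ncard_coe_finset, Set.ncard_coe_finset, or_comm,
        ← good_iff]
      exact h v h1

end LeafLabelledTree

/-! ### Support of the contraction, and rescaling of the bad splits -/

namespace SetWeight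

open Finset
open scoped Classical

variable {α : Type*} [Fintype α] {o : α} {k : ℕ} {f : Finset α → ℝ}

theorem badSum_nonneg (hf : ∀ A, 0 ≤ f A) : 0 ≤ badSum k f := sum_nonneg fun A _ => hf A

/-- Only pendant splits gain weight, and those are in the support already; so the contraction
inherits laminarity. -/
theorem ne_zero_of_contract_ne_zero (hp : ∀ i, 0 < f (pendant o i)) {A : Finset α}
    (hA : contract o k f A ≠ 0) : f A ≠ 0 := by
  intro h
  apply hA
  have hA' : A ∉ univ.image (pendant o) := by
    intro h'
    obtain ⟨i, -, rfl⟩ := mem_image.1 h'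
    exact (hp i).ne' h
  simp [contract, h, hA']

theorem good_of_contract_ne_zero (hkn : k + 1 ≤ Fintype.card α) {A : Finset α}
    (hA : contract o k f A ≠ 0) : Good k A := by
  by_contra h
  apply hA
  have hA' : A ∉ univ.image (pendant o) := by
    intro h'
    obtain ⟨i, -, rfl⟩ := mem_image.1 h'
    exact h (good_pendant hkn o i)
  simp [contract, h, hA']

theorem isClusterWeight_contract (hf : ∀ A, 0 ≤ f A) (ho : ∀ A, f A ≠ 0 → o ∉ A)
    (hl : Laminar f) (hp : ∀ i, 0 < f (pendant o i)) : IsClusterWeight o (contract o k f) where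
  nonneg A := by
    have := badSum_nonneg (k := k) hf
    have := hf A
    unfold contract
    split_ifs <;> positivity
  not_mem A hA := ho A (ne_zero_of_contract_ne_zero hp hA)
  empty := by simp [contract]
  laminar A B hA hB :=
    hl A B (ne_zero_of_contract_ne_zero hp hA) (ne_zero_of_contract_ne_zero hp hB)

theorem contract_eq_self (hf : ∀ A, 0 ≤ f A) (h0 : f ∅ = 0) (hbad : badSum k f = 0) :
    contract o k f = f := by
  funext A
  by_cases hA : A = ∅
  · simp [contract, hA, h0]
  · rw [contract_of_ne f hA, hbad]
    by_cases hg : Good k A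
    · simp [hg]
    · have := (sum_eq_zero_iff_of_nonneg fun A _ => hf A).1 hbad A (by simp [hg])
      simp [hg, this]

/-- The factors that rescale the weights of the edges which divide every `k`-set, so that they
add up to `k * x`, and compensate for that at the leaves. -/
theorem exists_rescaling (hk : 2 ≤ k) (hkn : k + 1 ≤ Fintype.card α)
    (hp : ∀ i, 0 < f (pendant o i)) (hbad : 0 < badSum k f) {x : ℝ} (hx : 0 < x)
    (hxm : ∀ i, x < contract o k f (pendant o i)) :
    ∃ c : Finset α → ℝ, (∀ A, 0 < c A) ∧ badSum k (fun A => c A * f A) = k * x ∧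
      contract o k (fun A => c A * f A) = contract o k f := by
  have hk' : (0 : ℝ) < k := by positivity
  have hn : 3 ≤ Fintype.card α := by omega
  -- The bad splits are scaled to total `k * x`, so contraction will add `x` to each pendant split.
  -- The pendant splits are therefore lowered to `contract o k f A - x`, positive by `hxm`.
  set s : ℝ := k * x / badSum k f with hs
  set c : Finset α → ℝ := fun A => if ¬ Good k A then s else
    if A ∈ univ.image (pendant o) then (contract o k f A - x) / f A else 1 with hc
  have hb : badSum k (fun A => c A * f A) = k * x := by
    have : badSum k (fun A => c A * f A) = s * badSum k f := by
      unfold badSum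
      rw [mul_sum]
      refine sum_congr rfl fun A hA => ?_
      simp only [hc, if_pos (mem_filter.1 hA).2]
    rw [this, hs]
    field_simp
  refine ⟨c, fun A => ?_, hb, ?_⟩
  · simp only [hc]
    split_ifs with h1 h2
    · obtain ⟨i, -, rfl⟩ := mem_image.1 h2
      exact div_pos (sub_pos.2 (hxm i)) (hp i)
    · exact one_pos
    · positivity
  · funext A
    by_cases hA : A = ∅
    · simp [contract, hA]
    by_cases hP : A ∈ univ.image (pendant o)
    · obtain ⟨i, -, rfl⟩ := mem_image.1 hP
      have hfi := (hp i).ne'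
      rw [contract_pendant hkn hn, hb]
      simp only [hc, good_pendant hkn o i, not_true, if_false, hP, if_true]
      field_simp
      ring
    · rw [contract_of_ne _ hA, contract_of_ne _ hA, if_neg hP, if_neg hP]
      by_cases hg : Good k A
      · simp only [hc, hg, hP, not_true, if_false, if_true, one_mul]
      · simp [hg]

end SetWeight

/-! ### Pendant splits, twigs and reweighting -/

namespace LeafLabelledTree

open SimpleGraph Finset SetWeight
open scoped Classical

variable {n : ℕ} {T : LeafLabelledTree n} {o : Fin n}

theorem multiweight_eq_sepSum (I : Finset (Fin n)) :
    T.multiweight I = sepSum (T.splitWeight o) I := by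
  rw [multiweight_eq_sum (o := o), sepSum]
  refine sum_congr ?_ fun _ _ => rfl
  ext A
  rw [mem_filter, mem_filter]
  rfl

theorem not_mem_of_splitWeight_ne_zero (A : Finset (Fin n)) (hA : T.splitWeight o A ≠ 0) :
    o ∉ A := by
  obtain ⟨v, hv, rfl⟩ := exists_of_splitWeight_ne_zero hA
  exact not_mem_cluster hv

theorem laminar_splitWeight : Laminar (T.splitWeight o) := by
  intro A B hA hB
  obtain ⟨u, -, rfl⟩ := exists_of_splitWeight_ne_zero hA
  obtain ⟨v, -, rfl⟩ := exists_of_splitWeight_ne_zero hB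
  exact cluster_laminar u v

theorem isClusterWeight (hL : T.LeafSetEq) (hp : T.PositiveWeighted) :
    IsClusterWeight o (T.splitWeight o) where
  nonneg := hp.splitWeight_nonneg
  not_mem := not_mem_of_splitWeight_ne_zero
  empty := by
    by_contra h
    obtain ⟨v, -, hv⟩ := exists_of_splitWeight_ne_zero h
    exact (cluster_nonempty hL v).ne_empty hv
  laminar := laminar_splitWeight

variable (T o) in
/-- The edge at a leaf, by its lower end. -/
theorem exists_cluster_eq_pendant (i : Fin n) : ∃ v u, v ≠ T.leaf o ∧
    T.cluster o v = pendant o i ∧ T.G.Adj (T.leaf i) u ∧ T.w s(T.leaf i, u) = T.parWeight o v := by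
  by_cases hi : i = o
  · subst hi
    obtain ⟨c, hc⟩ := card_pos.1 ((card_children_root (T := T) (o := i)).symm ▸ one_pos)
    obtain ⟨h1, h2⟩ := mem_children.1 hc
    have h3 := T.adj_par i h1
    rw [h2] at h3
    refine ⟨c, c, h1, (cluster_child_root hc).trans (pendant_self i).symm, h3.symm, ?_⟩
    rw [parWeight, h2, Sym2.eq_swap]
  · have hne : T.leaf i ≠ T.leaf o := fun h => hi (T.leaf_injective h)
    exact ⟨T.leaf i, T.par o (T.leaf i), hne, (cluster_leaf hi).trans (pendant_of_ne hi).symm,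
      T.adj_par o hne, rfl⟩

theorem PositiveWeighted.splitWeight_pendant_pos (hp : T.PositiveWeighted) (i : Fin n) :
    0 < T.splitWeight o (pendant o i) := by
  obtain ⟨v, -, hv, h, -⟩ := T.exists_cluster_eq_pendant o i
  exact h ▸ hp.splitWeight_pos hv

theorem Essential.splitWeight_cluster (hE : T.Essential) (hL : T.LeafSetEq) {v : T.V}
    (hv : v ≠ T.leaf o) : T.splitWeight o (T.cluster o v) = T.parWeight o v := by
  unfold splitWeight
  refine sum_eq_single _ (fun u hu hne => ?_) fun h => ?_
  · exact absurd (eq_of_cluster_eq hL (hE u) (hE v) (mem_filter.1 hu).2.2) hne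
  · exact absurd (by simp [hv]) h

theorem eq_of_adj_of_deg_eq_one {x u u' : T.V} (hx : T.deg x = 1) (h : T.G.Adj x u)
    (h' : T.G.Adj x u') : u' = u := by
  obtain ⟨y, hy⟩ := Set.ncard_eq_one.1 hx
  have h1 : u ∈ T.G.neighborSet x := h
  have h2 : u' ∈ T.G.neighborSet x := h'
  rw [hy] at h1 h2
  exact h2.trans h1.symm

/-- Two adjacent vertices of degree one would form a whole component, leaving no place for a third
label. -/
theorem deg_ne_one_of_adj_leaf (hn : 3 ≤ n) {i : Fin n} {u : T.V} (h : T.G.Adj (T.leaf i) u) :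
    T.deg u ≠ 1 := by
  intro hu
  have hlt : #({T.leaf i, u} : Finset T.V) < #(univ.image T.leaf) := by
    rw [card_image_of_injective _ T.leaf_injective, card_univ, Fintype.card_fin]
    exact card_le_two.trans_lt hn
  obtain ⟨x, hx, hx'⟩ := exists_mem_notMem_of_card_lt_card hlt
  obtain ⟨a, b, hab, ha, hb⟩ := exists_crossing (T.isTree.connected.preconnected (T.leaf i) x)
    (fun z => z ∈ ({T.leaf i, u} : Finset T.V)) (by simp) hx'
  simp only [mem_insert, mem_singleton, not_or] at ha hb
  rcases ha with rfl | rfl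
  · exact hb.2 (eq_of_adj_of_deg_eq_one (deg_leaf i) h hab)
  · exact hb.1 (eq_of_adj_of_deg_eq_one hu h.symm hab)

/-- The neighbour of a leaf has degree neither one nor two, so it is a node and each twig is a
single edge. -/
theorem Essential.twigWeights_eq (hE : T.Essential) (hL : T.LeafSetEq) (hn : 3 ≤ n) :
    T.twigWeights = Set.range fun i => T.splitWeight o (pendant o i) := by
  have key : ∀ i, ∃ u, T.G.Adj (T.leaf i) u ∧ 2 < T.deg u ∧
      T.w s(T.leaf i, u) = T.splitWeight o (pendant o i) := by
    intro i
    obtain ⟨v, u, hv, hc, hadj, hw⟩ := T.exists_cluster_eq_pendant o i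
    refine ⟨u, hadj, ?_, ?_⟩
    · have h1 := deg_ne_one_of_adj_leaf hn hadj
      have h2 := hE u
      have h0 : 0 < T.deg u := (Set.ncard_pos (Set.toFinite _)).2 ⟨T.leaf i, hadj.symm⟩
      omega
    · rw [hw, ← hc, hE.splitWeight_cluster hL hv]
  ext r
  constructor
  · rintro ⟨i, N, p, ⟨hp, hN, hs⟩, rfl⟩
    obtain ⟨u, hadj, hu, hw⟩ := key i
    refine ⟨i, ?_⟩
    cases p with
    | nil => rw [deg_leaf] at hN; omega
    | @cons _ c _ h q =>
      obtain rfl := eq_of_adj_of_deg_eq_one (deg_leaf i) hadj h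
      obtain rfl := hs c (by simp) hu
      rw [Walk.cons_isPath_iff] at hp
      obtain rfl : q = Walk.nil := (Walk.isPath_iff_nil.1 hp.1).eq_nil
      simp [walkWeight, hw]
  · rintro ⟨i, rfl⟩
    obtain ⟨u, hadj, hu, hw⟩ := key i
    refine ⟨i, u, hadj.toWalk, ⟨Walk.IsPath.of_adj hadj, hu, fun x hx hx2 => ?_⟩, ?_⟩
    · have : x = T.leaf i ∨ x = u := by simpa using hx
      rcases this with rfl | h
      · rw [deg_leaf] at hx2; omega
      · exact h
    · simp [walkWeight, hw]

variable (T o) in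
/-- The same tree, with the weight of each edge multiplied by a factor that depends on the split
of the edge. -/
noncomputable def reweight (c : Finset (Fin n) → ℝ) : LeafLabelledTree n :=
  { T with
    w := fun e => if h : ∃ v, v ≠ T.leaf o ∧ s(v, T.par o v) = e then
      c (T.cluster o h.choose) * T.w e else T.w e }

theorem reweight_parWeight (c : Finset (Fin n) → ℝ) {v : T.V} (hv : v ≠ T.leaf o) :
    (T.reweight o c).w s(v, T.par o v) = c (T.cluster o v) * T.parWeight o v := by
  have h : ∃ u, u ≠ T.leaf o ∧ s(u, T.par o u) = s(v, T.par o v) := ⟨v, hv, rfl⟩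
  have e : h.choose = v := edge_injective h.choose_spec.1 hv h.choose_spec.2
  change (if h : ∃ u, u ≠ T.leaf o ∧ s(u, T.par o u) = s(v, T.par o v) then
      c (T.cluster o h.choose) * T.w s(v, T.par o v) else T.w s(v, T.par o v)) = _
  rw [dif_pos h, e, parWeight]

theorem reweight_splitWeight (c : Finset (Fin n) → ℝ) :
    (T.reweight o c).splitWeight o = fun A => c A * T.splitWeight o A := by
  funext A
  -- Only the weights change, so the parents and clusters are definitionally those of `T`.
  have h : (T.reweight o c).splitWeight o A = ∑ v with v ≠ T.leaf o ∧ T.cluster o v = A,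
      (T.reweight o c).w s(v, T.par o v) := rfl
  rw [h, splitWeight, mul_sum]
  refine sum_congr rfl fun v hv => ?_
  obtain ⟨h1, rfl⟩ := (mem_filter.1 hv).2
  exact reweight_parWeight (T := T) c h1

theorem reweight_leafSetEq (c : Finset (Fin n) → ℝ) (hL : T.LeafSetEq) :
    (T.reweight o c).LeafSetEq := hL

theorem reweight_positiveWeighted {c : Finset (Fin n) → ℝ} (hc : ∀ A, 0 < c A)
    (hp : T.PositiveWeighted) : (T.reweight o c).PositiveWeighted := by
  intro e he
  simp only [reweight]
  split_ifs
  · exact mul_pos (hc _) (hp e he)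
  · exact hp e he

end LeafLabelledTree

/-! ### The pseudostar, the supremum and the infimum -/

open LeafLabelledTree SetWeight

section

open scoped Classical

variable {n k : ℕ} {D : {I : Finset (Fin n) // I.card = k} → ℝ} {T Q : LeafLabelledTree n}

theorem LeafLabelledTree.realizes_iff (o : Fin n) :
    T.Realizes D ↔ ∀ I, sepSum (T.splitWeight o) I.1 = D I := by
  simp only [LeafLabelledTree.Realizes, multiweight_eq_sepSum (o := o)]

theorem exists_essential_pseudostar (hk : 2 ≤ k) (hkn : k + 1 ≤ n) (hD : PLTreelike D) :
    ∃ P ∈ positiveRealizations D, P.Essential ∧ P.IsPseudostar k := by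
  obtain ⟨T, hp, hT⟩ := hD
  let o : Fin n := ⟨0, by omega⟩
  have hkn' : k + 1 ≤ Fintype.card (Fin n) := by simpa using hkn
  have hn' : 3 ≤ Fintype.card (Fin n) := by omega
  have hpend := fun i => hp.splitWeight_pendant_pos (o := o) i
  -- Here `T` may have unlabelled leaves, so edges with empty cluster can carry weight. They lie in
  -- no minimal subtree spanned by labels, and `contract` drops them.
  have hg : IsClusterWeight o (contract o k (T.splitWeight o)) :=
    isClusterWeight_contract hp.splitWeight_nonneg not_mem_of_splitWeight_ne_zero
      laminar_splitWeight hpend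
  have hgp : ∀ i, 0 < contract o k (T.splitWeight o) (pendant o i) := by
    intro i
    rw [contract_pendant hkn' hn']
    have := badSum_nonneg (k := k) (hp.splitWeight_nonneg (o := o))
    have := hpend i
    positivity
  refine ⟨clusterTree hg hgp, ⟨clusterTree_leafSetEq hg hgp, clusterTree_positiveWeighted hg hgp,
    (realizes_iff o).2 fun I => ?_⟩, clusterTree_essential hg hgp,
    (isPseudostar_iff (o := o)).2 ⟨clusterTree_leafSetEq hg hgp, fun v hv => ?_⟩⟩
  · rw [clusterTree_splitWeight, sepSum_contract hk hkn' o _ I.2]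
    exact (realizes_iff o).1 hT I
  · have := ((clusterTree_positiveWeighted hg hgp).splitWeight_pos hv).ne'
    rw [clusterTree_splitWeight] at this
    exact good_of_contract_ne_zero hkn' this

/-- Contracting the edges of a realization that divide every `k`-set gives the pseudostar. -/
theorem contract_splitWeight_eq (hk : 2 ≤ k) (hkn : k + 1 ≤ n) (o : Fin n)
    (hT : T ∈ positiveRealizations D) (hQ : Q ∈ positiveRealizations D) (hQk : Q.IsPseudostar k) :
    contract o k (T.splitWeight o) = Q.splitWeight o := by
  have hkn' : k + 1 ≤ Fintype.card (Fin n) := by simpa using hkn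
  refine eq_of_sepSum_eq hk hkn' (isClusterWeight_contract hT.2.1.splitWeight_nonneg
    not_mem_of_splitWeight_ne_zero laminar_splitWeight hT.2.1.splitWeight_pendant_pos)
    (isClusterWeight hQ.1 hQ.2.1) (fun A => good_of_contract_ne_zero hkn') (fun A hA => ?_)
    fun I hI => ?_
  · obtain ⟨v, hv, rfl⟩ := exists_of_splitWeight_ne_zero hA
    exact ((isPseudostar_iff (o := o)).1 hQk).2 v hv
  · rw [sepSum_contract hk hkn' o _ hI, (realizes_iff o).1 hT.2.2 ⟨I, hI⟩,
      (realizes_iff o).1 hQ.2.2 ⟨I, hI⟩]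

/-- Every realization contracts to the same pseudostar, so the gap in total weight is governed by
the bad weight alone. -/
theorem totalWeight_pseudostar_eq (hk : 2 ≤ k) (hkn : k + 1 ≤ n) (o : Fin n)
    (hT : T ∈ positiveRealizations D) (hQ : Q ∈ positiveRealizations D) (hQk : Q.IsPseudostar k) :
    Q.totalWeight = T.totalWeight + ((n : ℝ) - k) * (badSum k (T.splitWeight o) / k) := by
  rw [totalWeight_eq_sum (o := o), totalWeight_eq_sum (o := o),
    ← contract_splitWeight_eq hk hkn o hT hQ hQk,
    sum_contract hk (by simpa using hkn) o (isClusterWeight hT.1 hT.2.1).empty, Fintype.card_fin]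

theorem splitWeight_eq_of_badSum_eq_zero (hk : 2 ≤ k) (hkn : k + 1 ≤ n) {o : Fin n}
    (hT : T ∈ positiveRealizations D) (hQ : Q ∈ positiveRealizations D) (hQk : Q.IsPseudostar k)
    (h : badSum k (T.splitWeight o) = 0) : T.splitWeight o = Q.splitWeight o := by
  have hf := isClusterWeight (o := o) hT.1 hT.2.1
  rw [← contract_splitWeight_eq hk hkn o hT hQ hQk, contract_eq_self hf.nonneg hf.empty h]

theorem badSum_eq_zero_of_isPseudostar {o : Fin n} (hQk : Q.IsPseudostar k) :
    badSum k (Q.splitWeight o) = 0 := by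
  refine Finset.sum_eq_zero fun A hA => ?_
  by_contra h
  obtain ⟨v, hv, rfl⟩ := exists_of_splitWeight_ne_zero h
  exact (Finset.mem_filter.1 hA).2 (((isPseudostar_iff (o := o)).1 hQk).2 v hv)

theorem exists_realization_of_totalWeight (hk : 2 ≤ k) (hkn : k + 1 ≤ n) {o : Fin n}
    (hT : T ∈ positiveRealizations D) (hQ : Q ∈ positiveRealizations D) (hQk : Q.IsPseudostar k)
    (hbad : 0 < badSum k (T.splitWeight o)) {x : ℝ} (hx : 0 < x)
    (hxm : ∀ i, x < Q.splitWeight o (pendant o i)) :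
    ∃ T' ∈ positiveRealizations D, T'.totalWeight = Q.totalWeight - ((n : ℝ) - k) * x := by
  have hkn' : k + 1 ≤ Fintype.card (Fin n) := by simpa using hkn
  have hcon := contract_splitWeight_eq hk hkn o hT hQ hQk
  rw [← hcon] at hxm
  obtain ⟨c, hc, hcb, hcc⟩ := exists_rescaling hk hkn'
    hT.2.1.splitWeight_pendant_pos hbad hx hxm
  rw [← reweight_splitWeight] at hcb hcc
  have hmem : T.reweight o c ∈ positiveRealizations D := by
    refine ⟨reweight_leafSetEq c hT.1, reweight_positiveWeighted hc hT.2.1,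
      (realizes_iff o).2 fun I => ?_⟩
    rw [← sepSum_contract hk hkn' o _ I.2, hcc, hcon]
    exact (realizes_iff o).1 hQ.2.2 I
  refine ⟨_, hmem, ?_⟩
  have hk' : (k : ℝ) ≠ 0 := by positivity
  rw [totalWeight_pseudostar_eq hk hkn o hmem hQ hQk, hcb, mul_div_cancel_left₀ _ hk']
  ring

end

theorem theorem4p1 (n k : ℕ) (hk : 3 ≤ k) (hkn : k ≤ n - 1)
    (D : {I : Finset (Fin n) // I.card = k} → ℝ) (hDpos : ∀ I, 0 < D I) (hD : PLTreelike D) :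
    ∃ P ∈ positiveRealizations D,
      (P.Essential ∧ P.IsPseudostar k) ∧
      (∀ Q ∈ positiveRealizations D, Q.Essential → Q.IsPseudostar k → Q.Isomorphic P) ∧
      (IsLUB (LeafLabelledTree.totalWeight '' positiveRealizations D) P.totalWeight ∧
        ∀ T ∈ positiveRealizations D, T.totalWeight = P.totalWeight → T.Equivalent P) ∧
      ∃ m : ℝ, IsLeast P.twigWeights m ∧
        ((∃ T₁ ∈ positiveRealizations D, ∃ T₂ ∈ positiveRealizations D, ¬ T₁.Equivalent T₂) →
          IsGLB (LeafLabelledTree.totalWeight '' positiveRealizations D)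
              (P.totalWeight - ((n : ℝ) - (k : ℝ)) * m) ∧
            ∀ T ∈ positiveRealizations D,
              T.totalWeight ≠ P.totalWeight - ((n : ℝ) - (k : ℝ)) * m) := by
  have hk2 : 2 ≤ k := by omega
  have hkn1 : k + 1 ≤ n := by omega
  have hkn' : k + 1 ≤ Fintype.card (Fin n) := by simpa using hkn1
  have hn' : 3 ≤ Fintype.card (Fin n) := by omega
  let o : Fin n := ⟨0, by omega⟩
  have hnk : (0 : ℝ) < n - k := by
    have : (k : ℝ) + 1 ≤ n := by exact_mod_cast hkn1
    linarith
  have hk' : (0 : ℝ) < k := by positivity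
  obtain ⟨P, hP, hPe, hPk⟩ := exists_essential_pseudostar hk2 hkn1 hD
  have htot : ∀ T ∈ positiveRealizations D, P.totalWeight =
      T.totalWeight + ((n : ℝ) - k) * (badSum k (T.splitWeight o) / k) :=
    fun T hT => totalWeight_pseudostar_eq hk2 hkn1 o hT hP hPk
  have hbad : ∀ T ∈ positiveRealizations D, 0 ≤ badSum k (T.splitWeight o) :=
    fun T hT => badSum_nonneg hT.2.1.splitWeight_nonneg
  have heq : ∀ T ∈ positiveRealizations D, badSum k (T.splitWeight o) = 0 →
      T.splitWeight o = P.splitWeight o :=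
    fun T hT h => splitWeight_eq_of_badSum_eq_zero hk2 hkn1 hT hP hPk h
  refine ⟨P, hP, ⟨hPe, hPk⟩, fun Q hQ hQe hQk => ?_, ⟨?_, fun T hT h => ?_⟩, ?_⟩
  · exact (equivalent_of_splitWeight_eq hQ.1 hP.1 hQ.2.1 hP.2.1
      (heq Q hQ (badSum_eq_zero_of_isPseudostar hQk))).isomorphic hQe hPe
  · refine IsGreatest.isLUB ⟨⟨P, hP, rfl⟩, ?_⟩
    rintro _ ⟨T, hT, rfl⟩
    rw [htot T hT]
    have := hbad T hT
    have : 0 ≤ ((n : ℝ) - k) * (badSum k (T.splitWeight o) / k) := by positivity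
    linarith
  · refine equivalent_of_splitWeight_eq hT.1 hP.1 hT.2.1 hP.2.1 (heq T hT ?_)
    have h0 : ((n : ℝ) - k) * (badSum k (T.splitWeight o) / k) = 0 := by
      have := htot T hT
      linarith
    simpa [hnk.ne', hk'.ne'] using h0
  obtain ⟨i₀, -, hmin⟩ := Finset.exists_min_image Finset.univ
    (fun i => P.splitWeight o (pendant o i)) ⟨o, Finset.mem_univ o⟩
  set m := P.splitWeight o (pendant o i₀) with hm
  have hm0 : 0 < m := hP.2.1.splitWeight_pendant_pos i₀
  have hlt : ∀ T ∈ positiveRealizations D,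
      P.totalWeight - ((n : ℝ) - k) * m < T.totalWeight := by
    intro T hT
    -- The pendant weight `m` of `P` is that of `T` plus this quotient, and the former is strictly
    -- positive; so the infimum is not attained.
    have h1 : badSum k (T.splitWeight o) / k < m := by
      rw [hm, ← contract_splitWeight_eq hk2 hkn1 o hT hP hPk, contract_pendant hkn' hn']
      have := hT.2.1.splitWeight_pendant_pos (o := o) i₀
      linarith
    have h2 := mul_lt_mul_of_pos_left h1 hnk
    rw [htot T hT]
    linarith
  refine ⟨m, ?_, fun hineq => ⟨⟨?_, fun b hb => ?_⟩, fun T hT => (hlt T hT).ne'⟩⟩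
  · rw [hPe.twigWeights_eq (o := o) hP.1 (by omega)]
    refine ⟨⟨i₀, rfl⟩, ?_⟩
    rintro _ ⟨i, rfl⟩
    exact hmin i (Finset.mem_univ i)
  · rintro _ ⟨T, hT, rfl⟩
    exact (hlt T hT).le
  · have hex : ∃ T ∈ positiveRealizations D, 0 < badSum k (T.splitWeight o) := by
      obtain ⟨T₁, h₁, T₂, h₂, hne⟩ := hineq
      by_contra! hno
      refine hne (equivalent_of_splitWeight_eq h₁.1 h₂.1 h₁.2.1 h₂.2.1
        ((heq T₁ h₁ ?_).trans (heq T₂ h₂ ?_).symm))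
      · exact (hno T₁ h₁).antisymm (hbad T₁ h₁)
      · exact (hno T₂ h₂).antisymm (hbad T₂ h₂)
    obtain ⟨T, hT, hTb⟩ := hex
    by_contra! hbm
    have hlow : ∀ x, 0 < x → x < m → b ≤ P.totalWeight - ((n : ℝ) - k) * x := by
      intro x hx hxm
      obtain ⟨T', hT', h'⟩ := exists_realization_of_totalWeight hk2 hkn1 hT hP hPk hTb hx
        fun i => hxm.trans_le (hmin i (Finset.mem_univ i))
      rw [← h']
      exact hb ⟨T', hT', rfl⟩
    -- Such an `x` yields a realization of total weight below `b`; the maximum with `0` keeps `x`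
    -- positive.
    obtain ⟨x, hx1, hx2⟩ : ∃ x, max 0 ((P.totalWeight - b) / ((n : ℝ) - k)) < x ∧ x < m := by
      refine exists_between (max_lt hm0 ?_)
      rw [div_lt_iff₀ hnk]
      linarith
    have h1 := hlow x ((le_max_left _ _).trans_lt hx1) hx2
    have h2 := (div_lt_iff₀ hnk).1 ((le_max_right _ _).trans_lt hx1)
    linarith
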